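/- **Setting.** Hyperbolic 3-space is $\mathbb{H}^3$, with upper half space model $\{(x,y,z): z>0\}$, boundary $\mathbb{C}\cup\{\infty\}$, $\mathbb{C}$ being the $xy$-plane. In the hyperboloid model, $\mathbb{R}^{1,3}$ is identified with Hermitian $2\times2$ matrices by $(T,X,Y,Z)\mapsto\frac12\begin{pmatrix}T+Z&X+iY\\X-iY&T-Z\end{pmatrix}$, $SL(2,\mathbb{C})$ acts by $S\mapsto ASA^*$, and the point $p$ of the positive light cone defines the horosphere $\{q:\langle q,p\rangle=1\}$, centred at the ray of $p$, i.e. at $(X+iY)/(T-Z)\in\mathbb{C}\cup\{\infty\}$. A *decoration* on a horosphere $\mathfrak h$ is a parallel unit tangent vector field $V$ on it (equivalently a parallel oriented line field). With $N^{in},N^{out}$ the unit normals pointing away from and towards the centre, $V$ gives the frame fields $(N^{in},V,N^{in}\times V)$ and $(N^{out},V,N^{out}\times V)$. A *spin decoration* $W=(W^{in},W^{out})$ is a pair of continuous lifts of these two frame fields to the spin double cover of the bundle of right-handed orthonormal frames, such that $W^{in}$ is $W^{out}$ rotated by $\pi$ about $V$ and $W^{out}$ is $W^{in}$ rotated by $-\pi$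 about $V$. Spin frames are identified with $SL(2,\mathbb{C})$, the identity lying over the frame $(e_z,e_y,-e_x)$ at $(0,0,1)$, and $A$ over its image under $A$. *Spinors.* To each $\kappa=(\xi,\eta)\in\mathbb{C}^2\setminus\{0\}$ corresponds the spin-decorated horosphere $\widetilde{\mathbf K}(\kappa)$ whose horosphere is that of the point $\kappa\kappa^*$ of the light cone, whose decoration points along the flag of $\kappa$ (i.e. lies in the half plane $\mathbb{R}\,\kappa\kappa^*+\mathbb{R}_{>0}(\kappa Z^*+Z\kappa^*)$, $Z=(i\bar\eta,-i\bar\xi)$), and whose outward spin decoration is the set of all $A\in SL(2,\mathbb{C})$ with first column $\kappa$ (the continuous $SL(2,\mathbb{C})$-equivariant lift). We say that $\kappa$ is the spin vector of $\widetilde{\mathbf K}(\kappa)$. *The plane.* $\mathbb{H}^2$ is the half plane $y=0$, with $\partial\mathbb{H}^2=\mathbb{R}\cup\{\infty\}$ oriented along $\mathbb{R}$ in the negative direction. A horocycle of $\mathbb{H}^2$ extends to a unique horosphere of $\mathbb{H}^3$; a *planar spin decoration* on the horocycle is a spin decoration on this horosphere whose decoration is specified by $i$, i.e. points in the direction $e_y$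 at the north pole of the horosphere (at every point, if the centre is $\infty$). *Polygons.* A *generalised ideal $d$-gon* is a $d$-tuple of points of $\partial\mathbb{H}^2$; it is *degenerate* if all its vertices coincide. It is an *ideal $d$-gon* if the vertices are distinct and labelled in cyclic order around the oriented circle $\partial\mathbb{H}^2$. A *generalised ideal $d$-gon with planar spin decorations* carries at each vertex $z_i$ a horocycle $\mathfrak h_i$ centred at $z_i$ with a planar spin decoration $W_i$. For distinct centres, the *complex distance* $d_{ij}=\rho_{ij}+i\theta_{ij}$ (modulo $4\pi i$) is such that translation by $\rho_{ij}$ along the geodesic from $z_i$ to $z_j$ followed by rotation by $\theta_{ij}$ about it takes $W_i^{in}$ to $W_j^{out}$, these spin frames being taken where the geodesic meets $\mathfrak h_i$ and $\mathfrak h_j$; the *lambda length* is $\lambda_{ij}=e^{d_{ij}/2}$. The decorations are *spin-coherent* if the vertices are distinct, $\lambda_{ij}>0$ for $i<j$ and $\lambda_{ij}<0$ for $i>j$. **Statement.** Let $d\ge0$. For every generalised ideal $d$-gon with planar spin decorations, each decorated vertex has exactly one spin vector $\kappa_i$, and $\kappa_i\in\mathbb{R}^2$. The map which sends the polygon to the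 real matrix with columns $\kappa_1,\dots,\kappa_d$ is 1. a bijection from the generalised ideal $d$-gons with planar spin decorations onto the $2\times d$ real matrices with no zero column; 2. restricts to a bijection from the nondegenerate generalised ideal $d$-gons with planar spin decorations onto the $2\times d$ real matrices of rank $2$ with no zero column; 3. if $d\ge2$, restricts to a bijection from the ideal $d$-gons with spin-coherent planar spin decorations onto the $2\times d$ real matrices all of whose $2\times2$ minors (with columns $i<j$, in this order) are positive. -/

import Mathlib

open Matrix OnePoint
open scoped ComplexConjugate

namespace SpinHyp

noncomputable section

/-! ### Minkowski space, Hermitian matrices and the action of `SL(2,ℂ)` -/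

/-- Minkowski space `ℝ^{1,3}`, with coordinates `(T, X, Y, Z) = (x 0, x 1, x 2, x 3)`. -/
abbrev Minkowski : Type := Fin 4 → ℝ

/-- The Lorentzian inner product `TT' - XX' - YY' - ZZ'`. -/
def minkInner (x y : Minkowski) : ℝ := x 0 * y 0 - x 1 * y 1 - x 2 * y 2 - x 3 * y 3

/-- The group `SL(2,ℂ)`. -/
abbrev SL2C : Type := Matrix.SpecialLinearGroup (Fin 2) ℂ

/-- The linear isomorphism from Minkowski space to Hermitian `2 × 2` matrices,
`(T,X,Y,Z) ↦ (1/2) [[T+Z, X+iY], [X-iY, T-Z]]`. -/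
def toHermitian (x : Minkowski) : Matrix (Fin 2) (Fin 2) ℂ :=
  !![((x 0 : ℂ) + x 3) / 2, ((x 1 : ℂ) + Complex.I * x 2) / 2;
     ((x 1 : ℂ) - Complex.I * x 2) / 2, ((x 0 : ℂ) - x 3) / 2]

/-- The inverse isomorphism, `[[a, b+ci], [b-ci, d]] ↦ (a+d, 2b, 2c, a-d)` on Hermitian matrices. -/
def ofHermitian (S : Matrix (Fin 2) (Fin 2) ℂ) : Minkowski :=
  ![(S 0 0).re + (S 1 1).re, 2 * (S 0 1).re, 2 * (S 0 1).im, (S 0 0).re - (S 1 1).re]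

/-- The action of `SL(2,ℂ)` on Minkowski space, induced by `S ↦ A S A*` on Hermitian matrices. -/
def act (A : SL2C) (x : Minkowski) : Minkowski :=
  ofHermitian ((A : Matrix (Fin 2) (Fin 2) ℂ) * toHermitian x * (A : Matrix (Fin 2) (Fin 2) ℂ)ᴴ)

/-- The hyperboloid model of hyperbolic 3-space. The tangent space at `q` is `q^⊥`, with the
Riemannian metric given by minus the Lorentzian inner product. -/
def hyperboloid : Set Minkowski := {q | 0 < q 0 ∧ minkInner q q = 1}

/-- The positive light cone; its rays are the points of the sphere at infinity. -/
def lightCone : Set Minkowski := {p | 0 < p 0 ∧ minkInner p p = 0}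

/-- The cross product of vectors `u, v` tangent to the hyperboloid at `q`: the tangent vector `w`
with `-⟨w, x⟩ = det (q, u, v, x)` for all `x`. At `(1,0,0,0)` it is the usual right-handed cross
product in the coordinates `X, Y, Z`. -/
def cross (q u v : Minkowski) : Minkowski :=
  ![-(Matrix.of ![q, u, v, ![1, 0, 0, 0]]).det, (Matrix.of ![q, u, v, ![0, 1, 0, 0]]).det,
    (Matrix.of ![q, u, v, ![0, 0, 1, 0]]).det, (Matrix.of ![q, u, v, ![0, 0, 0, 1]]).det]

/-! ### Frames and spin frames -/

/-- A triple of vectors at a point. All the triples used below are right-handed orthonormal frames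
of hyperbolic space. -/
@[ext] structure Frame where
  pos : Minkowski
  v1 : Minkowski
  v2 : Minkowski
  v3 : Minkowski

/-- Rotation by the angle `θ` about the first vector (right-handed). -/
def Frame.rotateFirst (θ : ℝ) (F : Frame) : Frame where
  pos := F.pos
  v1 := F.v1
  v2 := Real.cos θ • F.v2 + Real.sin θ • F.v3
  v3 := -Real.sin θ • F.v2 + Real.cos θ • F.v3

/-- Rotation by the angle `θ` about the second vector (right-handed). -/
def Frame.rotateSecond (θ : ℝ) (F : Frame) : Frame where
  pos := F.pos
  v1 := Real.cos θ • F.v1 - Real.sin θ • F.v3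
  v2 := F.v2
  v3 := Real.sin θ • F.v1 + Real.cos θ • F.v3

/-- Parallel translation by the signed distance `ρ` along the oriented geodesic through the
basepoint which is directed by the first vector. -/
def Frame.translate (ρ : ℝ) (F : Frame) : Frame where
  pos := Real.cosh ρ • F.pos + Real.sinh ρ • F.v1
  v1 := Real.sinh ρ • F.pos + Real.cosh ρ • F.v1
  v2 := F.v2
  v3 := F.v3

/-- The double cover `Spin → Fr` of the bundle of right-handed orthonormal frames. `SL(2,ℂ)` acts
simply transitively on spin frames, so the total space of `Spin` is `SL(2,ℂ)`; the spin frame `A`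
lies over the image under the isometry `A` of the base frame `(∂_Z, ∂_Y, -∂_X)` at `(1,0,0,0)`
(in the upper half space model, the frame `(e_z, e_y, -e_x)` at `(0,0,1)`). -/
def spinProj (A : SL2C) : Frame where
  pos := act A ![1, 0, 0, 0]
  v1 := act A ![0, 0, 0, 1]
  v2 := act A ![0, 0, 1, 0]
  v3 := act A ![0, -1, 0, 0]

/-- The spin frame `s'` is obtained from the spin frame `s` by following the path of frames
`F t`, `0 ≤ t ≤ 1`: the lift of this path to spin frames which starts at `s` ends at `s'`. -/
def SpinTransport (F : ℝ → Frame) (s s' : SL2C) : Prop :=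
  ∃ γ : ℝ → SL2C, Continuous γ ∧ (∀ t, spinProj (γ t) = F t) ∧ γ 0 = s ∧ γ 1 = s'

/-- Rotating the spin frame `s` by the angle `θ` about the first vector of its frame gives `s'`. -/
def SpinRotateFirst (θ : ℝ) (s s' : SL2C) : Prop :=
  SpinTransport (fun t => (spinProj s).rotateFirst (t * θ)) s s'

/-- Rotating the spin frame `s` by the angle `θ` about the second vector of its frame gives `s'`. -/
def SpinRotateSecond (θ : ℝ) (s s' : SL2C) : Prop :=
  SpinTransport (fun t => (spinProj s).rotateSecond (t * θ)) s s'

/-- Translating the spin frame `s` by the signed distance `ρ` along the geodesic directed by the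
first vector of its frame gives `s'`. -/
def SpinTranslate (ρ : ℝ) (s s' : SL2C) : Prop :=
  SpinTransport (fun t => (spinProj s).translate (t * ρ)) s s'

/-! ### Horospheres, decorations and spin decorations -/

/-- The horosphere cut out of the hyperboloid by the lightlike 3-plane `⟨q, p⟩ = 1`. -/
def horosphereOf (p : Minkowski) : Set Minkowski := {q | q ∈ hyperboloid ∧ minkInner q p = 1}

/-- A horosphere in hyperbolic 3-space. -/
structure Horosphere where
  carrier : Set Minkowski
  exists_normal : ∃ p ∈ lightCone, carrier = horosphereOf p

/-- The point of the light cone defining a horosphere (it is unique). -/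
def Horosphere.normal (h : Horosphere) : Minkowski := h.exists_normal.choose

/-- The centre of the horosphere, the point at infinity given by the ray through its normal, as a
point of `ℂ ∪ {∞}`, the boundary of the upper half space model. -/
def Horosphere.centre (h : Horosphere) : OnePoint ℂ :=
  open Classical in
  if h.normal 0 = h.normal 3 then ∞
  else (((h.normal 1 + Complex.I * h.normal 2) / (h.normal 0 - h.normal 3) : ℂ) : OnePoint ℂ)

/-- The outward unit normal (towards the centre) to a horosphere at its point `q`. -/
def Horosphere.outNormal (h : Horosphere) (q : h.carrier) : Minkowski := h.normal - q

/-- The inward unit normal (away from the centre) to a horosphere at its point `q`. -/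
def Horosphere.inNormal (h : Horosphere) (q : h.carrier) : Minkowski := q - h.normal

/-- The parabolic elements of `SL(2,ℂ)` (including `±1`). -/
def IsParabolic (A : SL2C) : Prop :=
  (A : Matrix (Fin 2) (Fin 2) ℂ).trace = 2 ∨ (A : Matrix (Fin 2) (Fin 2) ℂ).trace = -2

/-- `V` is a unit parallel tangent vector field on the horosphere: it is invariant under the
parabolic isometries which preserve the horosphere. -/
structure Horosphere.IsUnitParallel (h : Horosphere) (V : h.carrier → Minkowski) : Prop where
  tangent_hyperboloid : ∀ q, minkInner (V q) q = 0
  tangent_horosphere : ∀ q, minkInner (V q) h.normal = 0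
  unit : ∀ q, -minkInner (V q) (V q) = 1
  parallel : ∀ A : SL2C, IsParabolic A → act A '' h.carrier = h.carrier →
    ∀ q q' : h.carrier, (q' : Minkowski) = act A q → V q' = act A (V q)

/-- The outward frame field `(N^out, V, N^out × V)`. -/
def Horosphere.outFrame (h : Horosphere) (V : h.carrier → Minkowski) (q : h.carrier) : Frame where
  pos := q
  v1 := h.outNormal q
  v2 := V q
  v3 := cross q (h.outNormal q) (V q)

/-- The inward frame field `(N^in, V, N^in × V)`. -/
def Horosphere.inFrame (h : Horosphere) (V : h.carrier → Minkowski) (q : h.carrier) : Frame where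
  pos := q
  v1 := h.inNormal q
  v2 := V q
  v3 := cross q (h.inNormal q) (V q)

/-- A spin-decorated horosphere: a horosphere with a pair of an inward and an outward spin
decoration (continuous lifts to spin frames of the inward and outward frame fields of a unit
parallel vector field `V`) associated to each other: `W^in` is `W^out` rotated by `π` about `V`,
and `W^out` is `W^in` rotated by `-π` about `V`. -/
structure SpinDecoratedHorosphere extends Horosphere where
  win : carrier → SL2C
  wout : carrier → SL2C
  continuous_win : Continuous win
  continuous_wout : Continuous wout
  associated : ∃ V : carrier → Minkowski, toHorosphere.IsUnitParallel V ∧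
    (∀ q, spinProj (win q) = toHorosphere.inFrame V q) ∧
    (∀ q, spinProj (wout q) = toHorosphere.outFrame V q) ∧
    (∀ q, SpinRotateSecond Real.pi (wout q) (win q)) ∧
    (∀ q, SpinRotateSecond (-Real.pi) (win q) (wout q))

/-- The decoration underlying a spin decoration: the unit parallel vector field `V` such that
`W^in`, `W^out` lift the frame fields of `V`. -/
def SpinDecoratedHorosphere.direction (w : SpinDecoratedHorosphere) (q : w.carrier) : Minkowski :=
  (spinProj (w.wout q)).v2

/-! ### Planar spin decorations -/

/-- The isometry from the hyperboloid model to the upper half space model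
`{(z, t) : z ∈ ℂ, t > 0}`. It maps the points with `Y = 0` to the half plane over `ℝ`. -/
def toUpper (x : Minkowski) : ℂ × ℝ :=
  (((x 1 : ℂ) + Complex.I * x 2) / ((x 0 : ℂ) - x 3), 1 / (x 0 - x 3))

/-- The vector field `V` on the horosphere is specified by the complex number `α`: in the upper
half space model, at every highest point of the horosphere (the north pole if the horosphere is a
sphere, every point if it is a horizontal plane), `V` points in the horizontal direction `α`. -/
def Horosphere.IsSpecifiedBy (h : Horosphere) (V : h.carrier → Minkowski) (α : ℂ) : Prop :=
  ∀ q : h.carrier, (∀ q' : h.carrier, (toUpper q').2 ≤ (toUpper q).2) →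
    ∃ c : ℝ, 0 < c ∧ fderiv ℝ toUpper q (V q) = ((c : ℂ) * α, 0)

/-- A planar spin decoration on the horocycle centred at `z ∈ ∂ℍ² = ℝ ∪ {∞}` in which the
horosphere meets `ℍ²` (the upper half plane over `ℝ` in upper half space; a horocycle of `ℍ²`
extends to a unique horosphere of `ℍ³`, which has the same centre): a spin decoration on the
horosphere whose frames are specified by `i`. -/
def SpinDecoratedHorosphere.IsPlanarAt (w : SpinDecoratedHorosphere) (z : OnePoint ℝ) : Prop :=
  w.centre = z.map ((↑) : ℝ → ℂ) ∧ w.toHorosphere.IsSpecifiedBy w.direction Complex.I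

/-! ### Complex lambda lengths -/

/-- `d = ρ + iθ` is a complex distance from the spin frame `s₁` to the spin frame `s₂`: translation
by `ρ` along the oriented geodesic directed by the first vector of the frame, and then rotation by
`θ` about this geodesic, takes `s₁` to `s₂`. -/
def IsComplexDistance (s₁ s₂ : SL2C) (d : ℂ) : Prop :=
  ∃ s : SL2C, SpinTranslate d.re s₁ s ∧ SpinRotateFirst d.im s s₂

/-- The geodesic of hyperbolic space joining the points at infinity given by `p₁, p₂` on the light
cone. -/
def geodesic (p₁ p₂ : Minkowski) : Set Minkowski :=
  {q | q ∈ hyperboloid ∧ ∃ a b : ℝ, 0 < a ∧ 0 < b ∧ q = a • p₁ + b • p₂}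

/-- `l` is the complex lambda length from `w₁` to `w₂`: it is `0` if the centres agree, and
otherwise `exp (d/2)`, where `d` is a complex distance from `W₁^in(q₁)` to `W₂^out(q₂)` and `q₁, q₂`
are the points where the geodesic joining the centres meets the horospheres. -/
def IsLambdaLength (w₁ w₂ : SpinDecoratedHorosphere) (l : ℂ) : Prop :=
  (w₁.centre = w₂.centre ∧ l = 0) ∨
  (w₁.centre ≠ w₂.centre ∧ ∃ (q₁ : w₁.carrier) (q₂ : w₂.carrier) (d : ℂ),
    (q₁ : Minkowski) ∈ geodesic w₁.normal w₂.normal ∧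
    (q₂ : Minkowski) ∈ geodesic w₁.normal w₂.normal ∧
    IsComplexDistance (w₁.win q₁) (w₂.wout q₂) d ∧ l = Complex.exp (d / 2))

/-! ### Ideal polygons -/

/-- A generalised ideal `d`-gon in the hyperbolic plane (an arbitrary `d`-tuple of points of
`∂ℍ² = ℝ ∪ {∞}`) with a horocycle and a planar spin decoration at each vertex. -/
structure DecoratedPolygon (d : ℕ) where
  vertex : Fin d → OnePoint ℝ
  dec : Fin d → SpinDecoratedHorosphere
  planar : ∀ i, (dec i).IsPlanarAt (vertex i)

/-- A generalised ideal polygon is degenerate if all its vertices coincide. -/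
def DecoratedPolygon.IsDegenerate {d : ℕ} (P : DecoratedPolygon d) : Prop :=
  ∀ i j, P.vertex i = P.vertex j

/-- The points of `ℝ ∪ {∞}`, cut open at `∞`, as a linear order in which `∞` is greatest. -/
def cut (z : OnePoint ℝ) : WithTop ℝ := z.elim ⊤ (fun x => (x : WithTop ℝ))

/-- The points `z_0, …, z_{d-1}` are distinct and lie in cyclic order around the circle
`ℝ ∪ {∞}`, oriented along `ℝ` in the negative direction. -/
def InOrder {d : ℕ} (z : Fin d → OnePoint ℝ) : Prop :=
  Function.Injective z ∧ ∀ i j k, i < j → j < k →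
    (cut (z i) > cut (z j) ∧ cut (z j) > cut (z k)) ∨
    (cut (z j) > cut (z k) ∧ cut (z k) > cut (z i)) ∨
    (cut (z k) > cut (z i) ∧ cut (z i) > cut (z j))

/-- The underlying generalised ideal polygon is an ideal polygon. -/
def DecoratedPolygon.IsIdealPolygon {d : ℕ} (P : DecoratedPolygon d) : Prop := InOrder P.vertex

/-- The planar spin decorations are spin-coherent: the centres are distinct, and the lambda length
`λ_ij` is positive for `i < j` and negative for `i > j`. -/
def DecoratedPolygon.IsSpinCoherent {d : ℕ} (P : DecoratedPolygon d) : Prop :=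
  Function.Injective P.vertex ∧ ∀ i j,
    (i < j → ∃ l : ℝ, 0 < l ∧ IsLambdaLength (P.dec i) (P.dec j) l) ∧
    (j < i → ∃ l : ℝ, l < 0 ∧ IsLambdaLength (P.dec i) (P.dec j) l)

/-! ### The spinor–horosphere correspondence -/

theorem toHermitian_ofHermitian {S : Matrix (Fin 2) (Fin 2) ℂ} (hS : Sᴴ = S) :
    toHermitian (ofHermitian S) = S := by
  have h00 := congrFun (congrFun hS 0) 0
  have h01 := congrFun (congrFun hS 0) 1
  have h10 := congrFun (congrFun hS 1) 0
  have h11 := congrFun (congrFun hS 1) 1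
  simp only [conjTranspose_apply, Complex.ext_iff, Complex.star_def, Complex.conj_re,
    Complex.conj_im] at h00 h01 h10 h11
  ext i j
  fin_cases i <;> fin_cases j <;>
    simp [toHermitian, ofHermitian, Complex.ext_iff] <;>
    (try constructor) <;> linarith [h00.2, h01.1, h01.2, h10.1, h10.2, h11.2]

theorem ofHermitian_toHermitian (x : Minkowski) : ofHermitian (toHermitian x) = x := by
  ext i
  fin_cases i <;> simp [toHermitian, ofHermitian] <;> ring

theorem toHermitian_conjTranspose (x : Minkowski) : (toHermitian x)ᴴ = toHermitian x := by
  ext i j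
  fin_cases i <;> fin_cases j <;> simp [toHermitian, Complex.ext_iff]

theorem toHermitian_act (A : SL2C) (x : Minkowski) :
    toHermitian (act A x) = (A : Matrix (Fin 2) (Fin 2) ℂ) * toHermitian x *
      (A : Matrix (Fin 2) (Fin 2) ℂ)ᴴ := by
  apply toHermitian_ofHermitian
  simp [Matrix.conjTranspose_mul, toHermitian_conjTranspose, Matrix.mul_assoc]

theorem toHermitian_injective : Function.Injective toHermitian :=
  Function.LeftInverse.injective ofHermitian_toHermitian

theorem act_mul (A B : SL2C) (x : Minkowski) : act (A * B) x = act A (act B x) := by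
  apply toHermitian_injective
  simp [toHermitian_act, Matrix.conjTranspose_mul, Matrix.mul_assoc]

theorem act_neg (A : SL2C) (x : Minkowski) : act (-A) x = act A x := by
  apply toHermitian_injective
  simp [toHermitian_act]

theorem act_one (x : Minkowski) : act 1 x = x := by
  apply toHermitian_injective
  simp [toHermitian_act]

theorem toHermitian_add (x y : Minkowski) :
    toHermitian (x + y) = toHermitian x + toHermitian y := by
  ext i j
  fin_cases i <;> fin_cases j <;> simp [toHermitian] <;> ring

theorem toHermitian_smul (c : ℝ) (x : Minkowski) :
    toHermitian (c • x) = (c : ℂ) • toHermitian x := by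
  ext i j
  fin_cases i <;> fin_cases j <;> simp [toHermitian] <;> ring

theorem act_add (A : SL2C) (x y : Minkowski) : act A (x + y) = act A x + act A y := by
  apply toHermitian_injective
  simp [toHermitian_act, toHermitian_add, Matrix.mul_add, Matrix.add_mul]

theorem act_smul (A : SL2C) (c : ℝ) (x : Minkowski) : act A (c • x) = c • act A x := by
  apply toHermitian_injective
  simp [toHermitian_act, toHermitian_smul]

theorem minkInner_self (x : Minkowski) : (minkInner x x : ℂ) = 4 * (toHermitian x).det := by
  simp only [minkInner, toHermitian, det_fin_two_of]
  push_cast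
  linear_combination -((x 2 : ℂ) ^ 2) * Complex.I_sq

theorem minkInner_act_self (A : SL2C) (x : Minkowski) :
    minkInner (act A x) (act A x) = minkInner x x := by
  have h : (minkInner (act A x) (act A x) : ℂ) = minkInner x x := by
    rw [minkInner_self, minkInner_self, toHermitian_act]
    simp [det_conjTranspose]
  exact_mod_cast h

theorem minkInner_act (A : SL2C) (x y : Minkowski) :
    minkInner (act A x) (act A y) = minkInner x y := by
  have h1 := minkInner_act_self A (x + y)
  have h2 := minkInner_act_self A x
  have h3 := minkInner_act_self A y
  rw [act_add] at h1
  simp only [minkInner, Pi.add_apply] at h1 h2 h3 ⊢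
  linarith

/-- The matrix of the rotation by `θ` about the second vector of the base frame. -/
def rotMatrix (θ : ℝ) : SL2C :=
  ⟨!![(Real.cos (θ / 2) : ℂ), -Real.sin (θ / 2); Real.sin (θ / 2), Real.cos (θ / 2)], by
    rw [det_fin_two_of]
    have := Real.sin_sq_add_cos_sq (θ / 2)
    norm_cast
    linarith⟩

theorem act_rotMatrix (θ : ℝ) (x : Minkowski) : act (rotMatrix θ) x =
    ![x 0, Real.cos θ * x 1 + Real.sin θ * x 3, x 2, Real.cos θ * x 3 - Real.sin θ * x 1] := by
  have hs : Real.sin θ = 2 * Real.sin (θ / 2) * Real.cos (θ / 2) := by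
    rw [← Real.sin_two_mul]; congr 1; ring
  have hc : Real.cos θ = Real.cos (θ / 2) ^ 2 - Real.sin (θ / 2) ^ 2 := by
    rw [← Real.cos_two_mul']; congr 1; ring
  have h1 := Real.sin_sq_add_cos_sq (θ / 2)
  have h2 : (Complex.sin ((θ : ℂ) / 2)) = ((Real.sin (θ / 2) : ℝ) : ℂ) := by push_cast; rfl
  have h3 : (Complex.cos ((θ : ℂ) / 2)) = ((Real.cos (θ / 2) : ℝ) : ℂ) := by push_cast; rfl
  rw [hs, hc]
  simp only [act, rotMatrix]
  generalize Real.sin (θ / 2) = s at *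
  generalize Real.cos (θ / 2) = c at *
  ext i
  fin_cases i <;>
    simp [ofHermitian, toHermitian, Matrix.mul_apply, Fin.sum_univ_two]
  · linear_combination (x 0) * h1
  · ring
  · linear_combination (x 2) * h1
  · ring

theorem spinProj_mul_rotMatrix (A : SL2C) (θ : ℝ) :
    spinProj (A * rotMatrix θ) = (spinProj A).rotateSecond θ := by
  have e (x y z : Minkowski) (a b : ℝ) (h : x = a • y + b • z) :
      act A x = a • act A y + b • act A z := by rw [h, act_add, act_smul, act_smul]
  ext1 <;> simp only [spinProj, Frame.rotateSecond, act_mul, act_rotMatrix]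
  · congr 1; ext i; fin_cases i <;> simp
  · have h := e ![0, Real.sin θ, 0, Real.cos θ] ![0, 0, 0, 1] ![0, -1, 0, 0]
      (Real.cos θ) (-Real.sin θ) (by ext i; fin_cases i <;> simp)
    rw [neg_smul, ← sub_eq_add_neg] at h
    rw [← h]
    congr 1; ext i; fin_cases i <;> simp
  · congr 1; ext i; fin_cases i <;> simp
  · apply e; ext i; fin_cases i <;> simp

theorem rotMatrix_zero : rotMatrix 0 = 1 := by
  ext i j; fin_cases i <;> fin_cases j <;> simp [rotMatrix]

theorem rotMatrix_pi_mul_neg_pi : rotMatrix Real.pi * rotMatrix (-Real.pi) = 1 := by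
  have h : Complex.sin (-(Real.pi : ℂ) / 2) = -1 := by
    rw [neg_div, Complex.sin_neg, Complex.sin_pi_div_two]
  have h' : Complex.cos (-(Real.pi : ℂ) / 2) = 0 := by
    rw [neg_div, Complex.cos_neg, Complex.cos_pi_div_two]
  apply Subtype.ext
  rw [Matrix.SpecialLinearGroup.coe_mul]
  ext i j; fin_cases i <;> fin_cases j <;>
    simp [rotMatrix, Matrix.mul_apply, Fin.sum_univ_two, h, h']

theorem continuous_rotMatrix : Continuous rotMatrix := by
  refine Continuous.subtype_mk (continuous_matrix fun i j => ?_) _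
  fin_cases i <;> fin_cases j <;> simp <;> fun_prop

theorem spinRotateSecond_mul (A : SL2C) (θ : ℝ) : SpinRotateSecond θ A (A * rotMatrix θ) :=
  ⟨fun t => A * rotMatrix (t * θ),
    continuous_const.mul (continuous_rotMatrix.comp (continuous_mul_const θ)),
    fun t => spinProj_mul_rotMatrix A (t * θ), by simp [rotMatrix_zero], by simp⟩

theorem cross_apply (q u v : Minkowski) : cross q u v =
    ![(q 1 * (u 2 * v 3 - u 3 * v 2) - q 2 * (u 1 * v 3 - u 3 * v 1) + q 3 * (u 1 * v 2 - u 2 * v 1)),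
      (q 0 * (u 2 * v 3 - u 3 * v 2) - q 2 * (u 0 * v 3 - u 3 * v 0) + q 3 * (u 0 * v 2 - u 2 * v 0)),
      -(q 0 * (u 1 * v 3 - u 3 * v 1) - q 1 * (u 0 * v 3 - u 3 * v 0) + q 3 * (u 0 * v 1 - u 1 * v 0)),
      (q 0 * (u 1 * v 2 - u 2 * v 1) - q 1 * (u 0 * v 2 - u 2 * v 0) + q 2 * (u 0 * v 1 - u 1 * v 0))] := by
  ext i
  fin_cases i <;>
    simp [cross, det_succ_row_zero, Fin.sum_univ_succ, Fin.succAbove] <;> ring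

theorem spinProj_v3 (A : SL2C) :
    (spinProj A).v3 = cross (spinProj A).pos (spinProj A).v1 (spinProj A).v2 := by
  obtain ⟨M, hM⟩ := A
  have hd := hM
  rw [det_fin_two, Complex.ext_iff] at hd
  simp only [Complex.sub_re, Complex.sub_im, Complex.mul_re, Complex.mul_im, Complex.one_re,
    Complex.one_im] at hd
  obtain ⟨hr, hi⟩ := hd
  simp only [spinProj, act, cross_apply]
  have e0 : M 0 0 = ⟨(M 0 0).re, (M 0 0).im⟩ := rfl
  clear hM
  simp only [ofHermitian, Matrix.mul_apply, Fin.sum_univ_two, conjTranspose_apply, toHermitian]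
  generalize M 0 0 = a at *
  generalize M 0 1 = b at *
  generalize M 1 0 = c at *
  generalize M 1 1 = d at *
  obtain ⟨a, a'⟩ := a
  obtain ⟨b, b'⟩ := b
  obtain ⟨c, c'⟩ := c
  obtain ⟨d, d'⟩ := d
  simp at hr hi ⊢
  refine ⟨?_, ?_, ?_, ?_⟩
  · linear_combination (a * b + a' * b' + c * d + c' * d') * ((a * d - a' * d' - (b * c - b' * c') + 1) * hr +
      (a * d' + a' * d - (b * c' + b' * c)) * hi)
  · linear_combination (a * d + a' * d' + b * c + b' * c') * ((a * d - a' * d' - (b * c - b' * c') + 1) * hr +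
      (a * d' + a' * d - (b * c' + b' * c)) * hi)
  · linear_combination (a' * d - a * d' + b' * c - b * c') * ((a * d - a' * d' - (b * c - b' * c') + 1) * hr +
      (a * d' + a' * d - (b * c' + b' * c)) * hi)
  · linear_combination (a * b + a' * b' - c * d - c' * d') * ((a * d - a' * d' - (b * c - b' * c') + 1) * hr +
      (a * d' + a' * d - (b * c' + b' * c)) * hi)

theorem minkInner_comm (x y : Minkowski) : minkInner x y = minkInner y x := by
  simp only [minkInner]; ring

theorem minkInner_add_right (x y z : Minkowski) :
    minkInner x (y + z) = minkInner x y + minkInner x z := by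
  simp only [minkInner, Pi.add_apply]; ring

/-- The point of the light cone defining a horosphere is unique. -/
theorem horosphereOf_injOn : Set.InjOn horosphereOf lightCone := by
  intro p hp p' hp' h
  obtain ⟨hp0, hpp⟩ := hp
  have key : ∀ n ∈ lightCone,
      minkInner n p * minkInner n (p' - (1 - minkInner p p' / 2) • p) = 0 := by
    intro n hn
    obtain ⟨hn0, hnn⟩ := hn
    by_cases hN : minkInner n p = 0
    · rw [hN, zero_mul]
    have hN' : 0 ≤ minkInner n p := by
      simp only [minkInner] at *
      have : (n 1 * p 1 + n 2 * p 2 + n 3 * p 3) ^ 2 ≤ (n 0 * p 0) ^ 2 := by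
        have e : (n 0 * p 0) ^ 2 = (n 1 ^ 2 + n 2 ^ 2 + n 3 ^ 2) * (p 1 ^ 2 + p 2 ^ 2 + p 3 ^ 2) := by
          linear_combination (p 0 ^ 2) * hnn + (n 1 ^ 2 + n 2 ^ 2 + n 3 ^ 2) * hpp
        rw [e]
        linarith [sq_nonneg (n 1 * p 2 - n 2 * p 1), sq_nonneg (n 1 * p 3 - n 3 * p 1),
          sq_nonneg (n 2 * p 3 - n 3 * p 2)]
      linarith [(abs_le_of_sq_le_sq' this (by positivity)).2]
    have hN0 : 0 < minkInner n p := lt_of_le_of_ne hN' (Ne.symm hN)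
    have hq : (1 / 2 : ℝ) • p + (1 / minkInner n p) • n ∈ horosphereOf p := by
      refine ⟨⟨?_, ?_⟩, ?_⟩
      · simp only [Pi.add_apply, Pi.smul_apply, smul_eq_mul]; positivity
      · have : minkInner ((1 / 2 : ℝ) • p + (1 / minkInner n p) • n)
            ((1 / 2 : ℝ) • p + (1 / minkInner n p) • n) = (1 / 4) * minkInner p p +
            (1 / minkInner n p) ^ 2 * minkInner n n + (1 / minkInner n p) * minkInner n p := by
          generalize 1 / minkInner n p = c
          simp only [minkInner, Pi.add_apply, Pi.smul_apply, smul_eq_mul]; ring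
        rw [this, hpp, hnn]; field_simp; simp
      · have : minkInner ((1 / 2 : ℝ) • p + (1 / minkInner n p) • n) p = (1 / 2) * minkInner p p +
            (1 / minkInner n p) * minkInner n p := by
          generalize 1 / minkInner n p = c
          simp only [minkInner, Pi.add_apply, Pi.smul_apply, smul_eq_mul]; ring
        rw [this, hpp]; field_simp; simp
    rw [h] at hq
    have h1 := hq.2
    have h2 : minkInner ((1 / 2 : ℝ) • p + (1 / minkInner n p) • n) p' = (1 / 2) * minkInner p p' +
        (1 / minkInner n p) * minkInner n p' := by
      generalize 1 / minkInner n p = c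
      simp only [minkInner, Pi.add_apply, Pi.smul_apply, smul_eq_mul]; ring
    have h3 : minkInner n (p' - (1 - minkInner p p' / 2) • p) =
        minkInner n p' - (1 - minkInner p p' / 2) * minkInner n p := by
      generalize 1 - minkInner p p' / 2 = c
      simp only [minkInner, Pi.sub_apply, Pi.smul_apply, smul_eq_mul]; ring
    rw [h2] at h1
    rw [h3]
    field_simp at h1
    have h4 : minkInner n p' - (1 - minkInner p p' / 2) * minkInner n p = 0 := by linarith
    rw [h4, mul_zero]
  have k1 := key ![1, 1, 0, 0] (by simp [lightCone, minkInner])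
  have k2 := key ![1, -1, 0, 0] (by simp [lightCone, minkInner])
  have k3 := key ![1, 0, 1, 0] (by simp [lightCone, minkInner])
  have k4 := key ![1, 0, -1, 0] (by simp [lightCone, minkInner])
  have k5 := key ![1, 0, 0, 1] (by simp [lightCone, minkInner])
  have k6 := key ![1, 0, 0, -1] (by simp [lightCone, minkInner])
  have hw : p' = (1 - minkInner p p' / 2) • p := by
    rw [← sub_eq_zero]
    generalize p' - (1 - minkInner p p' / 2) • p = w at *
    simp [minkInner] at k1 k2 k3 k4 k5 k6 hpp
    have : w 0 = 0 ∧ w 1 = 0 ∧ w 2 = 0 ∧ w 3 = 0 := by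
      have h12 : ¬ (p 0 ^ 2 = p 1 ^ 2 ∧ p 0 ^ 2 = p 2 ^ 2) := by
        rintro ⟨a, b⟩; nlinarith [sq_nonneg (p 3), sq_pos_of_pos hp0]
      have h13 : ¬ (p 0 ^ 2 = p 1 ^ 2 ∧ p 0 ^ 2 = p 3 ^ 2) := by
        rintro ⟨a, b⟩; nlinarith [sq_nonneg (p 2), sq_pos_of_pos hp0]
      have h23 : ¬ (p 0 ^ 2 = p 2 ^ 2 ∧ p 0 ^ 2 = p 3 ^ 2) := by
        rintro ⟨a, b⟩; nlinarith [sq_nonneg (p 1), sq_pos_of_pos hp0]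
      clear key h hp' 
      grind
    ext i; fin_cases i <;> simp [this]
  have hm : minkInner p p' = 0 := by
    rw [hw]
    generalize 1 - minkInner p p' / 2 = c
    simp only [minkInner, Pi.smul_apply, smul_eq_mul] at hpp ⊢
    linear_combination c * hpp
  rw [hm] at hw
  rw [hw]; simp

/-- The point `κ κ*` of the light cone, for a spinor `κ`. -/
def spinorNormal (κ : Fin 2 → ℂ) : Minkowski := ofHermitian (vecMulVec κ (star κ))

/-- The matrix with first column `κ` which maps the basepoint `(1,0,0,0)` to `q`, for `q` in the
horosphere of `κ κ*`. -/
def spinMatrix (κ : Fin 2 → ℂ) (q : Minkowski) : Matrix (Fin 2) (Fin 2) ℂ :=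
  !![κ 0, -(q 0 + q 3) * conj (κ 1) + (q 1 + Complex.I * q 2) * conj (κ 0);
     κ 1, -(q 1 - Complex.I * q 2) * conj (κ 1) + (q 0 - q 3) * conj (κ 0)]

theorem toHermitian_spinorNormal (κ : Fin 2 → ℂ) :
    toHermitian (spinorNormal κ) = vecMulVec κ (star κ) := by
  apply toHermitian_ofHermitian
  ext i j
  simp [vecMulVec_apply, mul_comm]

theorem spinorNormal_mem {κ : Fin 2 → ℂ} (hκ : κ ≠ 0) : spinorNormal κ ∈ lightCone := by
  constructor
  · have h : spinorNormal κ 0 = Complex.normSq (κ 0) + Complex.normSq (κ 1) := by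
      simp [spinorNormal, ofHermitian, vecMulVec_apply, Complex.normSq_apply]
    rw [h]
    by_contra hn
    have h0 := Complex.normSq_nonneg (κ 0)
    have h1 := Complex.normSq_nonneg (κ 1)
    apply hκ
    have k0 : κ 0 = 0 := Complex.normSq_eq_zero.mp (by linarith)
    have k1 : κ 1 = 0 := Complex.normSq_eq_zero.mp (by linarith)
    ext i
    fin_cases i <;> simp [k0, k1]
  · have h : (minkInner (spinorNormal κ) (spinorNormal κ) : ℂ) = 0 := by
      rw [minkInner_self, toHermitian_spinorNormal]
      simp [det_fin_two, vecMulVec_apply]; ring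
    exact_mod_cast h

theorem act_spinorNormal (A : SL2C) (κ : Fin 2 → ℂ) :
    act A (spinorNormal κ) = spinorNormal ((A : Matrix (Fin 2) (Fin 2) ℂ) *ᵥ κ) := by
  apply toHermitian_injective
  rw [toHermitian_act, toHermitian_spinorNormal, toHermitian_spinorNormal, star_mulVec,
    mul_vecMulVec, vecMulVec_mul]

theorem minkInner_spinorNormal (κ : Fin 2 → ℂ) (q : Minkowski) :
    (minkInner q (spinorNormal κ) : ℂ) = (q 0 - q 3) * (κ 0 * conj (κ 0)) +
      (q 0 + q 3) * (κ 1 * conj (κ 1)) - (q 1 + Complex.I * q 2) * (κ 1 * conj (κ 0))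
      - (q 1 - Complex.I * q 2) * (κ 0 * conj (κ 1)) := by
  apply Complex.ext <;>
  simp [minkInner, spinorNormal, ofHermitian, vecMulVec_apply] <;> ring

theorem det_spinMatrix {κ : Fin 2 → ℂ} {q : Minkowski} (hq : q ∈ horosphereOf (spinorNormal κ)) :
    (spinMatrix κ q).det = 1 := by
  have h := minkInner_spinorNormal κ q
  rw [hq.2] at h
  rw [spinMatrix, det_fin_two_of]
  push_cast at h
  linear_combination -h

theorem toHermitian_e0 : toHermitian ![1, 0, 0, 0] = (1 / 2 : ℂ) • 1 := by
  ext i j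
  fin_cases i <;> fin_cases j <;> simp [toHermitian]

/-- The frame matrix over the point `q` of the horosphere of `κ κ*`. -/
def spinSL (κ : Fin 2 → ℂ) (q : horosphereOf (spinorNormal κ)) : SL2C :=
  ⟨spinMatrix κ q, det_spinMatrix q.2⟩

theorem act_spinSL (κ : Fin 2 → ℂ) (q : horosphereOf (spinorNormal κ)) :
    act (spinSL κ q) ![1, 0, 0, 0] = q := by
  apply toHermitian_injective
  obtain ⟨q, ⟨h0, hqq⟩, hqp⟩ := q
  have h := minkInner_spinorNormal κ q
  rw [hqp] at h
  have h' : (q 0 + q 3 : ℂ) * (q 0 - q 3) - (q 1 + Complex.I * q 2) * (q 1 - Complex.I * q 2) =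
      1 := by
    have h1 : (minkInner q q : ℂ) = 1 := by rw [hqq]; simp
    simp only [minkInner] at h1
    push_cast at h1
    linear_combination h1 + (q 2 : ℂ) ^ 2 * Complex.I_sq
  push_cast at h
  rw [toHermitian_act, toHermitian_e0]
  ext i j
  fin_cases i <;> fin_cases j <;>
    simp [spinSL, spinMatrix, toHermitian, Matrix.mul_apply, Fin.sum_univ_two]
  · linear_combination (-(q 0 + q 3 : ℂ) / 2) * h - (κ 0 * conj (κ 0) / 2) * h'
  · linear_combination (-(q 1 + Complex.I * q 2 : ℂ) / 2) * h - (κ 0 * conj (κ 1) / 2) * h'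
  · linear_combination (-(q 1 - Complex.I * q 2 : ℂ) / 2) * h - (κ 1 * conj (κ 0) / 2) * h'
  · linear_combination (-(q 0 - q 3 : ℂ) / 2) * h - (κ 1 * conj (κ 1) / 2) * h'

theorem spinMatrix_of_SL (A : SL2C) :
    spinMatrix ((A : Matrix (Fin 2) (Fin 2) ℂ) *ᵥ ![1, 0]) (act A ![1, 0, 0, 0]) = A := by
  have hH := toHermitian_act A ![1, 0, 0, 0]
  rw [toHermitian_e0] at hH
  have hd := A.det_coe
  rw [det_fin_two] at hd
  replace hd := congrArg conj hd
  generalize act A ![1, 0, 0, 0] = q at *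
  have h00 := congrFun (congrFun hH 0) 0
  have h01 := congrFun (congrFun hH 0) 1
  have h10 := congrFun (congrFun hH 1) 0
  have h11 := congrFun (congrFun hH 1) 1
  simp [toHermitian, Matrix.mul_apply, Fin.sum_univ_two] at h00 h01 h10 h11 hd
  ext i j
  fin_cases i <;> fin_cases j <;>
    simp [spinMatrix, Matrix.mulVec, dotProduct, Fin.sum_univ_two]
  · linear_combination (-2 * conj (A 1 0)) * h00 + (2 * conj (A 0 0)) * h01 + A 0 1 * hd
  · linear_combination (-2 * conj (A 1 0)) * h10 + (2 * conj (A 0 0)) * h11 + A 1 1 * hd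

/-- The first column of a frame matrix is the spinor. -/
theorem spinSL_mulVec (κ : Fin 2 → ℂ) (q : horosphereOf (spinorNormal κ)) :
    (spinSL κ q : Matrix (Fin 2) (Fin 2) ℂ) *ᵥ ![1, 0] = κ := by
  ext i
  fin_cases i <;> simp [spinSL, spinMatrix, Matrix.mulVec, dotProduct, Fin.sum_univ_two]

theorem spinorNormal_one_zero : spinorNormal ![1, 0] = ![1, 0, 0, 1] := by
  ext i
  fin_cases i <;> simp [spinorNormal, ofHermitian, vecMulVec_apply]

theorem act_spinSL_normal (κ : Fin 2 → ℂ) (q : horosphereOf (spinorNormal κ)) :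
    act (spinSL κ q) ![1, 0, 0, 1] = spinorNormal κ := by
  rw [← spinorNormal_one_zero, act_spinorNormal, spinSL_mulVec]

/-- Equivariance of the frame matrices. -/
theorem spinMatrix_equivariant (A : SL2C) (κ : Fin 2 → ℂ) (q : horosphereOf (spinorNormal κ)) :
    spinMatrix ((A : Matrix (Fin 2) (Fin 2) ℂ) *ᵥ κ) (act A q) =
      (A : Matrix (Fin 2) (Fin 2) ℂ) * spinMatrix κ q := by
  have h := spinMatrix_of_SL (A * spinSL κ q)
  rw [act_mul, act_spinSL, Matrix.SpecialLinearGroup.coe_mul, ← Matrix.mulVec_mulVec,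
    spinSL_mulVec] at h
  exact h

theorem act_horosphere_subset (A : SL2C) (κ : Fin 2 → ℂ) :
    act A '' horosphereOf (spinorNormal κ) ⊆
      horosphereOf (spinorNormal ((A : Matrix (Fin 2) (Fin 2) ℂ) *ᵥ κ)) := by
  rintro _ ⟨q, hq, rfl⟩
  have hB : act (A * spinSL κ ⟨q, hq⟩) ![1, 0, 0, 0] = act A q := by rw [act_mul, act_spinSL]
  refine ⟨⟨?_, ?_⟩, ?_⟩
  · rw [← hB]
    generalize A * spinSL κ ⟨q, hq⟩ = B
    have h0 : act B ![1, 0, 0, 0] 0 = (Complex.normSq (B 0 0) + Complex.normSq (B 0 1) +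
        Complex.normSq (B 1 0) + Complex.normSq (B 1 1)) / 2 := by
      simp [act, ofHermitian, toHermitian, Matrix.mul_apply, Fin.sum_univ_two,
        Complex.normSq_apply]
      ring
    rw [h0]
    have n1 := Complex.normSq_nonneg (B 0 0)
    have n2 := Complex.normSq_nonneg (B 0 1)
    have n3 := Complex.normSq_nonneg (B 1 0)
    have n4 := Complex.normSq_nonneg (B 1 1)
    by_contra hn
    have z1 : B 0 0 = 0 := Complex.normSq_eq_zero.mp (by linarith)
    have z2 : B 0 1 = 0 := Complex.normSq_eq_zero.mp (by linarith)
    have hd := B.det_coe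
    rw [det_fin_two, z1, z2] at hd
    simp at hd
  · rw [minkInner_act_self]; exact hq.1.2
  · rw [← act_spinorNormal, minkInner_act]; exact hq.2

theorem act_horosphere (A : SL2C) (κ : Fin 2 → ℂ) :
    act A '' horosphereOf (spinorNormal κ) =
      horosphereOf (spinorNormal ((A : Matrix (Fin 2) (Fin 2) ℂ) *ᵥ κ)) := by
  refine Set.Subset.antisymm (act_horosphere_subset A κ) fun q hq => ?_
  refine ⟨act A⁻¹ q, ?_, ?_⟩
  · have h := act_horosphere_subset A⁻¹ ((A : Matrix (Fin 2) (Fin 2) ℂ) *ᵥ κ)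
      (Set.mem_image_of_mem _ hq)
    rwa [Matrix.mulVec_mulVec, ← Matrix.SpecialLinearGroup.coe_mul, inv_mul_cancel,
      Matrix.SpecialLinearGroup.coe_one, Matrix.one_mulVec] at h
  · rw [← act_mul, mul_inv_cancel, act_one]

/-- A parabolic isometry which preserves the horosphere of `κ κ*` maps `κ` to `±κ`. -/
theorem parabolic_mulVec (A : SL2C) (hA : IsParabolic A) {κ : Fin 2 → ℂ} (hκ : κ ≠ 0)
    (h : act A '' horosphereOf (spinorNormal κ) = horosphereOf (spinorNormal κ)) :
    (A : Matrix (Fin 2) (Fin 2) ℂ) *ᵥ κ = κ ∨ (A : Matrix (Fin 2) (Fin 2) ℂ) *ᵥ κ = -κ := by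
  have hne : (A : Matrix (Fin 2) (Fin 2) ℂ) *ᵥ κ ≠ 0 := fun h0 => hκ (by
    have := congrArg (fun v => (↑(A⁻¹) : Matrix (Fin 2) (Fin 2) ℂ) *ᵥ v) h0
    rwa [Matrix.mulVec_mulVec, ← Matrix.SpecialLinearGroup.coe_mul, inv_mul_cancel,
      Matrix.SpecialLinearGroup.coe_one, Matrix.one_mulVec, Matrix.mulVec_zero] at this)
  rw [act_horosphere] at h
  have hp := horosphereOf_injOn (spinorNormal_mem hne) (spinorNormal_mem hκ) h
  have hm := congrArg toHermitian hp
  rw [toHermitian_spinorNormal, toHermitian_spinorNormal] at hm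
  have hm' (i j : Fin 2) := congrFun (congrFun hm i) j
  simp only [vecMulVec_apply, Pi.star_apply, Complex.star_def] at hm'
  have hε : ∃ ε : ℂ, (A : Matrix (Fin 2) (Fin 2) ℂ) *ᵥ κ = ε • κ := by
    obtain ⟨j, hj⟩ := Function.ne_iff.mp hκ
    have hj' : ((A : Matrix (Fin 2) (Fin 2) ℂ) *ᵥ κ) j ≠ 0 := fun h0 => by
      have := hm' j j
      rw [h0] at this
      simp at this
      exact hj this
    refine ⟨conj (κ j) / conj (((A : Matrix (Fin 2) (Fin 2) ℂ) *ᵥ κ) j), ?_⟩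
    ext i
    have := hm' i j
    have hc : conj (((A : Matrix (Fin 2) (Fin 2) ℂ) *ᵥ κ) j) ≠ 0 := by simpa using hj'
    rw [Pi.smul_apply, smul_eq_mul, div_mul_eq_mul_div, eq_div_iff hc, this]
    ring
  obtain ⟨ε, hε⟩ := hε
  have hd := A.det_coe
  rw [det_fin_two] at hd
  have e0 := congrFun hε 0
  have e1 := congrFun hε 1
  simp [Matrix.mulVec, dotProduct, Fin.sum_univ_two] at e0 e1
  obtain ⟨j, hj⟩ := Function.ne_iff.mp hκ
  have hch : (ε ^ 2 - (A : Matrix (Fin 2) (Fin 2) ℂ).trace * ε + 1) * κ j = 0 := by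
    rw [trace_fin_two]
    fin_cases j
    · change _ * κ 0 = 0
      linear_combination (A 1 1 - ε) * e0 - A 0 1 * e1 - κ 0 * hd
    · change _ * κ 1 = 0
      linear_combination (A 0 0 - ε) * e1 - A 1 0 * e0 - κ 1 * hd
  have hch' := (mul_eq_zero.mp hch).resolve_right hj
  rw [hε]
  rcases hA with hA | hA <;> rw [hA] at hch'
  · left
    have : (ε - 1) ^ 2 = 0 := by linear_combination hch'
    rw [sub_eq_zero.mp (pow_eq_zero_iff two_ne_zero |>.mp this), one_smul]
  · right
    have : (ε + 1) ^ 2 = 0 := by linear_combination hch'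
    rw [eq_neg_of_add_eq_zero_left (pow_eq_zero_iff two_ne_zero |>.mp this), neg_one_smul]

theorem spinMatrix_neg (κ : Fin 2 → ℂ) (q : Minkowski) : spinMatrix (-κ) q = -spinMatrix κ q := by
  ext i j
  fin_cases i <;> fin_cases j <;> simp [spinMatrix] <;> ring

/-- The horosphere of a spinor. -/
def spinorHorosphere (κ : {κ : Fin 2 → ℂ // κ ≠ 0}) : Horosphere where
  carrier := horosphereOf (spinorNormal κ)
  exists_normal := ⟨spinorNormal κ, spinorNormal_mem κ.2, rfl⟩

theorem spinorHorosphere_normal (κ : {κ : Fin 2 → ℂ // κ ≠ 0}) :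
    (spinorHorosphere κ).normal = spinorNormal κ := by
  have h := (spinorHorosphere κ).exists_normal.choose_spec
  exact horosphereOf_injOn h.1 (spinorNormal_mem κ.2) h.2.symm

theorem spinorHorosphere_isUnitParallel (κ : {κ : Fin 2 → ℂ // κ ≠ 0}) :
    (spinorHorosphere κ).IsUnitParallel fun q => act (spinSL κ q) ![0, 0, 1, 0] where
  tangent_hyperboloid q := by
    have h := minkInner_act (spinSL κ q) ![0, 0, 1, 0] ![1, 0, 0, 0]
    have h' := act_spinSL κ q
    rw [h'] at h
    exact h.trans (by simp [minkInner])
  tangent_horosphere q := by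
    rw [spinorHorosphere_normal, ← act_spinSL_normal κ q, minkInner_act]
    simp [minkInner]
  unit q := by
    rw [minkInner_act_self]
    simp [minkInner]
  parallel A hA h q q' hq := by
    have he := spinMatrix_equivariant A κ q
    rw [← hq] at he
    rcases parabolic_mulVec A hA κ.2 h with hk | hk
    · rw [hk] at he
      have : spinSL κ q' = A * spinSL κ q := Subtype.ext he
      rw [this, act_mul]
    · rw [hk, spinMatrix_neg] at he
      have : spinSL κ q' = -(A * spinSL κ q) :=
        Subtype.ext (by rw [Matrix.SpecialLinearGroup.coe_neg]; exact neg_eq_iff_eq_neg.mp he)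
      rw [this, act_neg, act_mul]

theorem continuous_spinSL (κ : Fin 2 → ℂ) : Continuous (spinSL κ) := by
  have h (i : Fin 4) : Continuous fun q : horosphereOf (spinorNormal κ) =>
      (((q : Minkowski) i : ℝ) : ℂ) :=
    Complex.continuous_ofReal.comp ((continuous_apply i).comp continuous_subtype_val)
  refine Continuous.subtype_mk (continuous_matrix fun i j => ?_) _
  fin_cases i <;> fin_cases j
  · exact continuous_const
  · exact (((h 0).add (h 3)).neg.mul continuous_const).add
      (((h 1).add (continuous_const.mul (h 2))).mul continuous_const)
  · exact continuous_const
  · exact (((h 1).sub (continuous_const.mul (h 2))).neg.mul continuous_const).add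
      (((h 0).sub (h 3)).mul continuous_const)

theorem act_spinSL_outNormal (κ : Fin 2 → ℂ) (q : horosphereOf (spinorNormal κ)) :
    act (spinSL κ q) ![0, 0, 0, 1] = spinorNormal κ - q := by
  rw [eq_sub_iff_add_eq]
  conv_lhs => rw [← act_spinSL κ q]
  rw [← act_add, ← act_spinSL_normal κ q]
  congr 1
  ext i
  fin_cases i <;> simp

theorem spinProj_spinSL (κ : {κ : Fin 2 → ℂ // κ ≠ 0}) (q : (spinorHorosphere κ).carrier) :
    spinProj (spinSL κ q) =
      (spinorHorosphere κ).outFrame (fun q => act (spinSL κ q) ![0, 0, 1, 0]) q := by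
  have h0 : (spinProj (spinSL κ q)).pos = q := act_spinSL κ q
  have h1 : (spinProj (spinSL κ q)).v1 = (spinorHorosphere κ).outNormal q := by
    rw [Horosphere.outNormal, spinorHorosphere_normal]
    exact act_spinSL_outNormal κ q
  have h3 := spinProj_v3 (spinSL κ q)
  rw [h0, h1] at h3
  exact Frame.ext h0 h1 rfl h3

theorem spinProj_spinSL_mul (κ : {κ : Fin 2 → ℂ // κ ≠ 0}) (q : (spinorHorosphere κ).carrier) :
    spinProj (spinSL κ q * rotMatrix Real.pi) =
      (spinorHorosphere κ).inFrame (fun q => act (spinSL κ q) ![0, 0, 1, 0]) q := by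
  have h := spinProj_mul_rotMatrix (spinSL κ q) Real.pi
  have h0 : (spinProj (spinSL κ q * rotMatrix Real.pi)).pos = q := by
    rw [h]
    exact act_spinSL κ q
  have h1 : (spinProj (spinSL κ q * rotMatrix Real.pi)).v1 = (spinorHorosphere κ).inNormal q := by
    rw [h, spinProj_spinSL, Horosphere.inNormal]
    simp [Frame.rotateSecond, Horosphere.outFrame, Horosphere.outNormal]
  have h2 : (spinProj (spinSL κ q * rotMatrix Real.pi)).v2 =
      act (spinSL κ q) ![0, 0, 1, 0] := by rw [h]; rfl
  have h3 := spinProj_v3 (spinSL κ q * rotMatrix Real.pi)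
  rw [h0, h1, h2] at h3
  exact Frame.ext h0 h1 h2 h3

/-- The spinor–horosphere correspondence, from nonzero spinors to spin-decorated horospheres. Its
underlying decorated horosphere is given by the flag of `κ`: the horosphere is that of the point
`κ κ*` of the light cone, and its decoration points along the flag (see the two theorems below).
The outward spin decoration consists of all `A` in `SL(2,ℂ)` with first column `κ`. This choice of
lift to spin frames depends continuously on `κ` and is `SL(2,ℂ)`-equivariant; `(1,0)` corresponds to
a spin decoration which passes through the spin frame `1`. -/
def spinLift (κ : {κ : Fin 2 → ℂ // κ ≠ 0}) : SpinDecoratedHorosphere where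
  toHorosphere := spinorHorosphere κ
  wout := fun q => spinSL κ q
  win := fun q => spinSL κ q * rotMatrix Real.pi
  continuous_wout := continuous_spinSL κ
  continuous_win := (continuous_spinSL κ).mul continuous_const
  associated := by
    refine ⟨_, spinorHorosphere_isUnitParallel κ, fun q => spinProj_spinSL_mul κ q,
      fun q => spinProj_spinSL κ q, fun q => spinRotateSecond_mul _ _, fun q => ?_⟩
    have h := spinRotateSecond_mul (spinSL κ q * rotMatrix Real.pi) (-Real.pi)
    rwa [mul_assoc, rotMatrix_pi_mul_neg_pi, mul_one] at h

/-- The horosphere of `κ` is defined by the point `κ κ*` of the light cone. -/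
theorem spinLift_normal (κ : {κ : Fin 2 → ℂ // κ ≠ 0}) :
    toHermitian (spinLift κ).normal = vecMulVec κ (star (κ : Fin 2 → ℂ)) := by
  have h : (spinLift κ).normal = spinorNormal κ := spinorHorosphere_normal κ
  rw [h, toHermitian_spinorNormal]

/-- The decoration of the horosphere of `κ = (ξ, η)` points along the flag of `κ`: it lies in the
oriented plane spanned by `κ κ*` and `κ Z* + Z κ*`, where `Z = (i η̄, -i ξ̄)`. -/
theorem spinLift_direction (κ : {κ : Fin 2 → ℂ // κ ≠ 0}) (q : (spinLift κ).carrier) :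
    ∃ a b : ℝ, 0 < b ∧ toHermitian ((spinLift κ).direction q) =
      (a : ℂ) • vecMulVec κ (star (κ : Fin 2 → ℂ)) +
      (b : ℂ) • (vecMulVec κ (star ![Complex.I * conj (κ.1 1), -Complex.I * conj (κ.1 0)]) +
        vecMulVec ![Complex.I * conj (κ.1 1), -Complex.I * conj (κ.1 0)] (star (κ : Fin 2 → ℂ))) := by
  obtain ⟨κ, hκ⟩ := κ
  have hN : 0 < spinorNormal κ 0 := (spinorNormal_mem hκ).1
  have hN' : (spinorNormal κ 0 : ℂ) = κ 0 * conj (κ 0) + κ 1 * conj (κ 1) := by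
    apply Complex.ext <;> simp [spinorNormal, ofHermitian, vecMulVec_apply] <;> ring
  have hdir : toHermitian ((spinLift ⟨κ, hκ⟩).direction q) = spinMatrix κ q *
      toHermitian ![0, 0, 1, 0] * (spinMatrix κ q)ᴴ := toHermitian_act (spinSL κ q) ![0, 0, 1, 0]
  have hd : (spinMatrix κ q).det = 1 := det_spinMatrix q.2
  have c0 : spinMatrix κ q 0 0 = κ 0 := rfl
  have c1 : spinMatrix κ q 1 0 = κ 1 := rfl
  rw [det_fin_two] at hd
  rw [hdir]
  generalize spinMatrix κ q = B at *
  generalize spinorNormal κ 0 = N at *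
  rw [c0, c1] at hd
  have hNc : (N : ℂ) ≠ 0 := by exact_mod_cast hN.ne'
  obtain ⟨c, hc⟩ : ∃ c, c = (conj (κ 0) * B 0 1 + conj (κ 1) * B 1 1) / N := ⟨_, rfl⟩
  have b0 : B 0 1 = c * κ 0 - conj (κ 1) * (N : ℂ)⁻¹ := by
    rw [hc]
    field_simp
    rw [hN']
    linear_combination (-conj (κ 1)) * hd
  have b1 : B 1 1 = c * κ 1 + conj (κ 0) * (N : ℂ)⁻¹ := by
    rw [hc]
    field_simp
    rw [hN']
    linear_combination (conj (κ 0)) * hd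
  have him : (c.im : ℂ) = (conj c - c) * Complex.I / 2 := by
    apply Complex.ext <;> simp
  refine ⟨c.im, N⁻¹ / 2, by positivity, ?_⟩
  rw [him]
  ext i j
  simp only [Matrix.add_apply, Matrix.smul_apply, vecMulVec_apply, Pi.star_apply]
  fin_cases i <;> fin_cases j <;>
    simp [toHermitian, Matrix.mul_apply, Fin.sum_univ_two, c0, c1, b0, b1] <;> ring

/-- The outward spin decoration consists of all `A` in `SL(2,ℂ)` with first column `κ`. -/
theorem range_spinLift_wout (κ : {κ : Fin 2 → ℂ // κ ≠ 0}) :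
    Set.range (spinLift κ).wout = {A : SL2C | ∀ r, A r 0 = κ.1 r} := by
  ext A
  constructor
  · rintro ⟨q, rfl⟩ r
    fin_cases r <;> rfl
  · intro hA
    have hk : (A : Matrix (Fin 2) (Fin 2) ℂ) *ᵥ ![1, 0] = κ := by
      ext r
      rw [← hA r]
      simp [Matrix.mulVec, dotProduct, Fin.sum_univ_two]
    have h0 : (![1, 0, 0, 0] : Minkowski) ∈ horosphereOf (spinorNormal ![1, 0]) := by
      rw [spinorNormal_one_zero]
      simp [horosphereOf, hyperboloid, minkInner]
    have hq := act_horosphere_subset A ![1, 0] (Set.mem_image_of_mem _ h0)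
    rw [hk] at hq
    refine ⟨⟨_, hq⟩, Subtype.ext ?_⟩
    have h := spinMatrix_of_SL A
    rw [hk] at h
    exact h

/-- The spin-decorated horosphere `w` corresponds to the spinor `κ`. -/
def IsSpinVectorOf (κ : Fin 2 → ℂ) (w : SpinDecoratedHorosphere) : Prop :=
  ∃ h : κ ≠ 0, spinLift ⟨κ, h⟩ = w

end

end SpinHyp

namespace SpinHyp

/-! ### Spin frames over the same frame -/

/-! Everything reduces to the claim that planar spin-decorated horospheres are the same thing as
nonzero vectors `v` of `ℝ²`.

A horosphere centred on `ℝ ∪ {∞}` has a normal with `Y = 0`, that is, a positive real symmetric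
matrix of rank one; it equals `v vᵀ` with `v` real and unique up to sign, and the centre is `v 0 / v
1`. On this horosphere there is only one parallel unit field specified by `i`, because its value at
a highest point is forced and parabolics carry that value everywhere. The frame field of `v` is such
a field. Since `SL(2,ℂ)` covers the frames with fibres `{A, -A}` and a horosphere is connected, the
outward field has exactly two lifts, those of `v` and `-v`, and each determines its inward partner
(`exists_realSpinor_of_isPlanarAt`). The first column of any outward spin frame recovers the spin
vector, so it is unique (`spinLift_injective`).

Lambda lengths are minors. If `A` has first column `κ₁`, rotation by `π` followed by complex
translation by `d` turns `A` into a matrix with first column `exp (d/2)` times the second column of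
`A`. Equating this with `κ₂` gives `det (κ₁, κ₂) = exp (d/2)` (`IsLambdaLength.eq_det`,
`isLambdaLength_det`).

Hence two vertices coincide exactly when their minor vanishes, so nondegeneracy means rank 2
(`rank_eq_two_iff`), and spin-coherence means positivity of the minors with `i < j`. The cyclic
order of the vertices then comes for free: positive minors place the middle of three columns in the
open cone of the outer two (`cut_ratio_cyclic`). -/

theorem eq_one_or_eq_neg_one_of_act_eq (A : SL2C) (h0 : act A ![1, 0, 0, 0] = ![1, 0, 0, 0])
    (h1 : act A ![0, 0, 0, 1] = ![0, 0, 0, 1]) (h2 : act A ![0, 0, 1, 0] = ![0, 0, 1, 0]) :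
    A = 1 ∨ A = -1 := by
  have k0 := toHermitian_act A ![1, 0, 0, 0]
  have k1 := toHermitian_act A ![0, 0, 0, 1]
  have k2 := toHermitian_act A ![0, 0, 1, 0]
  rw [h0] at k0
  rw [h1] at k1
  rw [h2] at k2
  have hd := A.det_coe
  rw [det_fin_two] at hd
  have a0 := congrFun (congrFun k0 0) 0
  have a1 := congrFun (congrFun k1 0) 0
  have b0 := congrFun (congrFun k0 1) 1
  have b1 := congrFun (congrFun k1 1) 1
  have c2 := congrFun (congrFun k2 0) 1
  simp [toHermitian, Matrix.mul_apply, Fin.sum_univ_two] at a0 a1 b0 b1 c2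
  -- The first two fixed vectors are half of `1` and of `diag (1, -1)`; comparing the diagonal
  -- entries of their images kills the off-diagonal entries of `A`.
  have z1 : A 0 1 = 0 := by
    have : A 0 1 * conj (A 0 1) = 0 := by linear_combination a1 - a0
    simpa using this
  have z2 : A 1 0 = 0 := by
    have : A 1 0 * conj (A 1 0) = 0 := by linear_combination -b1 - b0
    simpa using this
  rw [z1, z2] at hd
  simp only [z1, z2] at a0 c2
  have hI := Complex.I_ne_zero
  -- The third fixed vector relates the two diagonal entries. As `A 0 0` has modulus one they are
  -- equal, and determinant one makes them `±1`.
  have e1 : A 0 0 * conj (A 1 1) = 1 := by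
    apply mul_left_cancel₀ hI
    simp at c2
    linear_combination -2 * c2
  have e2 : A 0 0 * conj (A 0 0) = 1 := by
    simp at a0
    linear_combination -2 * a0
  have e3 : A 0 0 = A 1 1 := by
    have hne : A 0 0 ≠ 0 := fun h => by simp [h] at e2
    have := mul_left_cancel₀ hne (e2.trans e1.symm)
    exact star_injective this
  have hs : (A 1 1 - 1) * (A 1 1 + 1) = 0 := by
    rw [e3] at hd
    linear_combination hd
  rcases mul_eq_zero.mp hs with h | h
  · left
    have h : A 1 1 = 1 := sub_eq_zero.mp h
    ext i j
    fin_cases i <;> fin_cases j <;> simp [z1, z2, e3, h]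
  · right
    have h : A 1 1 = -1 := eq_neg_of_add_eq_zero_left h
    ext i j
    fin_cases i <;> fin_cases j <;> simp [z1, z2, e3, h]

/-- `B⁻¹ * A` fixes the base frame, whose stabiliser is `±1`. -/
theorem eq_or_eq_neg_of_spinProj_eq {A B : SL2C} (h : spinProj A = spinProj B) :
    A = B ∨ A = -B := by
  have key (x : Minkowski) (hx : act A x = act B x) : act (B⁻¹ * A) x = x := by
    rw [act_mul, hx, ← act_mul, inv_mul_cancel, act_one]
  have e : A = B * (B⁻¹ * A) := by rw [mul_inv_cancel_left]
  rcases eq_one_or_eq_neg_one_of_act_eq (B⁻¹ * A) (key _ (congrArg Frame.pos h))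
    (key _ (congrArg Frame.v1 h)) (key _ (congrArg Frame.v2 h)) with h | h
  · left; rw [e, h, mul_one]
  · right; rw [e, h, mul_neg_one]

theorem ne_neg_self (A : SL2C) : A ≠ -A := by
  intro h
  have hd := A.det_coe
  have e (i j) : A i j = 0 := by
    have := congrArg (fun B : SL2C => B i j) h
    simp at this
    linear_combination this / 2
  rw [det_fin_two] at hd
  simp [e] at hd

theorem continuous_neg_SL : Continuous fun A : SL2C => -A := by
  refine Continuous.subtype_mk (continuous_subtype_val.neg) _

/-- Two continuous lifts of the same family of frames over a connected space agree up to a global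
sign. -/
theorem lifts_eq_or_eq_neg {X : Type*} [TopologicalSpace X] [PreconnectedSpace X]
    {f g : X → SL2C} (hf : Continuous f) (hg : Continuous g)
    (h : ∀ x, spinProj (f x) = spinProj (g x)) : f = g ∨ f = -g := by
  have c1 : IsClosed {x | f x = g x} := isClosed_eq hf hg
  have c2 : IsClosed {x | f x = -g x} := isClosed_eq hf (continuous_neg_SL.comp hg)
  -- Fibres have exactly two points, so the complement of the closed agreement set is closed too,
  -- and connectedness leaves only two cases.
  have hc : {x | f x = g x}ᶜ = {x | f x = -g x} := by
    ext x
    simp only [Set.mem_compl_iff, Set.mem_ofPred_eq]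
    constructor
    · exact fun hx => (eq_or_eq_neg_of_spinProj_eq (h x)).resolve_left hx
    · exact fun hx hx' => ne_neg_self (g x) (hx'.symm.trans hx)
  rcases isClopen_iff.mp (⟨c1, by rw [← isClosed_compl_iff, hc]; exact c2⟩ :
    IsClopen {x | f x = g x}) with h | h
  · right
    rw [h] at hc
    funext x
    exact (hc ▸ Set.mem_compl (Set.notMem_empty x) : x ∈ {x | f x = -g x})
  · left
    funext x
    exact (h ▸ Set.mem_univ x : x ∈ {x | f x = g x})

/-- Two lifts of a path over `ℝ` agree up to a global sign, and the common value at `0` rules out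
the minus sign. Transport may thus be computed with any explicit lift. -/
theorem SpinTransport.unique {F : ℝ → Frame} {s s₁ s₂ : SL2C} (h₁ : SpinTransport F s s₁)
    (h₂ : SpinTransport F s s₂) : s₁ = s₂ := by
  obtain ⟨γ₁, c₁, p₁, z₁, rfl⟩ := h₁
  obtain ⟨γ₂, c₂, p₂, z₂, rfl⟩ := h₂
  rcases lifts_eq_or_eq_neg c₁ c₂ fun t => (p₁ t).trans (p₂ t).symm with h | h
  · rw [h]
  · have := congrFun h 0
    rw [Pi.neg_apply, z₁, z₂] at this
    exact absurd this (ne_neg_self s)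

/-! ### Complex distances -/

/-- The loxodromic element with complex translation length `d` along the first vector of the base
frame. -/
noncomputable def loxMatrix (d : ℂ) : SL2C :=
  ⟨!![Complex.exp (d / 2), 0; 0, Complex.exp (-(d / 2))], by
    rw [det_fin_two_of, ← Complex.exp_add]; simp⟩

theorem loxMatrix_zero : loxMatrix 0 = 1 := by
  ext i j; fin_cases i <;> fin_cases j <;> simp [loxMatrix]

theorem loxMatrix_add (d e : ℂ) : loxMatrix (d + e) = loxMatrix d * loxMatrix e := by
  apply Subtype.ext
  rw [Matrix.SpecialLinearGroup.coe_mul]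
  ext i j
  fin_cases i <;> fin_cases j <;>
    simp [loxMatrix, Matrix.mul_apply, Fin.sum_univ_two, ← Complex.exp_add] <;> ring_nf

theorem continuous_loxMatrix : Continuous loxMatrix := by
  refine Continuous.subtype_mk (continuous_matrix fun i j => ?_) _
  fin_cases i <;> fin_cases j <;> simp <;> fun_prop

theorem act_loxMatrix_ofReal (ρ : ℝ) (x : Minkowski) : act (loxMatrix ρ) x =
    ![Real.cosh ρ * x 0 + Real.sinh ρ * x 3, x 1, x 2,
      Real.sinh ρ * x 0 + Real.cosh ρ * x 3] := by
  apply toHermitian_injective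
  rw [toHermitian_act]
  have e1 : conj (Complex.exp ((ρ : ℂ) / 2)) = Complex.exp ((ρ : ℂ) / 2) := by
    rw [← Complex.exp_conj]; simp [Complex.conj_ofNat]
  have e2 : conj (Complex.exp (-((ρ : ℂ) / 2))) = Complex.exp (-((ρ : ℂ) / 2)) := by
    rw [← Complex.exp_conj]; simp [Complex.conj_ofNat]
  have f1 : Complex.exp (ρ : ℂ) = Complex.exp ((ρ : ℂ) / 2) * Complex.exp ((ρ : ℂ) / 2) := by
    rw [← Complex.exp_add]; ring_nf
  have f2 : Complex.exp (-(ρ : ℂ)) =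
      Complex.exp (-((ρ : ℂ) / 2)) * Complex.exp (-((ρ : ℂ) / 2)) := by
    rw [← Complex.exp_add]; ring_nf
  have f3 : Complex.exp ((ρ : ℂ) / 2) * Complex.exp (-((ρ : ℂ) / 2)) = 1 := by
    rw [← Complex.exp_add]; simp
  ext i j
  fin_cases i <;> fin_cases j <;>
    simp [loxMatrix, toHermitian, Matrix.mul_apply, Fin.sum_univ_two, Complex.cosh,
      Complex.sinh, e1, e2, f1, f2]
  · ring
  · linear_combination ((x 1 + Complex.I * x 2) / 2) * f3
  · linear_combination ((x 1 - Complex.I * x 2) / 2) * f3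
  · ring

theorem act_loxMatrix_mul_I (θ : ℝ) (x : Minkowski) : act (loxMatrix (θ * Complex.I)) x =
    ![x 0, Real.cos θ * x 1 - Real.sin θ * x 2, Real.sin θ * x 1 + Real.cos θ * x 2, x 3] := by
  apply toHermitian_injective
  rw [toHermitian_act]
  have e1 : conj (Complex.exp ((θ : ℂ) * Complex.I / 2)) =
      Complex.exp (-((θ : ℂ) * Complex.I / 2)) := by
    rw [← Complex.exp_conj]; simp [Complex.conj_ofNat]; ring_nf
  have e2 : conj (Complex.exp (-((θ : ℂ) * Complex.I / 2))) =
      Complex.exp ((θ : ℂ) * Complex.I / 2) := by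
    rw [← Complex.exp_conj]; simp [Complex.conj_ofNat]; ring_nf
  have f1 : Complex.exp ((θ : ℂ) * Complex.I / 2) * Complex.exp ((θ : ℂ) * Complex.I / 2) =
      Complex.cos θ + Complex.sin θ * Complex.I := by
    rw [← Complex.exp_add, ← Complex.exp_mul_I]; ring_nf
  have f2 : Complex.exp (-((θ : ℂ) * Complex.I / 2)) * Complex.exp (-((θ : ℂ) * Complex.I / 2)) =
      Complex.cos θ - Complex.sin θ * Complex.I := by
    rw [← Complex.exp_add]
    have := Complex.exp_mul_I (-(θ : ℂ))
    rw [Complex.cos_neg, Complex.sin_neg] at this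
    rw [show Complex.cos θ - Complex.sin θ * Complex.I = Complex.cos θ + -Complex.sin θ * Complex.I
      by ring, ← this]
    ring_nf
  have f3 : Complex.exp ((θ : ℂ) * Complex.I / 2) * Complex.exp (-((θ : ℂ) * Complex.I / 2)) =
      1 := by
    rw [← Complex.exp_add]; simp
  ext i j
  fin_cases i <;> fin_cases j <;>
    simp [loxMatrix, toHermitian, Matrix.mul_apply, Fin.sum_univ_two, e1, e2]
  · linear_combination ((x 0 + x 3) / 2) * f3
  · linear_combination ((x 1 + Complex.I * x 2) / 2) * f1 +
      (x 2 : ℂ) / 2 * Complex.sin θ * Complex.I_sq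
  · linear_combination ((x 1 - Complex.I * x 2) / 2) * f2 +
      (x 2 : ℂ) / 2 * Complex.sin θ * Complex.I_sq
  · linear_combination ((x 0 - x 3) / 2) * f3

theorem act_add_smul (A : SL2C) {x y z : Minkowski} {a b : ℝ} (h : x = a • y + b • z) :
    act A x = a • act A y + b • act A z := by rw [h, act_add, act_smul, act_smul]

/-- A right factor moves the base frame before `A` is applied, so the motion takes place relative to
the frame of `A` itself. -/
theorem spinProj_mul_loxMatrix_ofReal (A : SL2C) (ρ : ℝ) :
    spinProj (A * loxMatrix ρ) = (spinProj A).translate ρ := by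
  ext1 <;> simp only [spinProj, Frame.translate, act_mul, act_loxMatrix_ofReal]
  · apply act_add_smul; ext i; fin_cases i <;> simp
  · apply act_add_smul; ext i; fin_cases i <;> simp
  · congr 1; ext i; fin_cases i <;> simp
  · congr 1; ext i; fin_cases i <;> simp

theorem spinProj_mul_loxMatrix_mul_I (A : SL2C) (θ : ℝ) :
    spinProj (A * loxMatrix (θ * Complex.I)) = (spinProj A).rotateFirst θ := by
  ext1 <;> simp only [spinProj, Frame.rotateFirst, act_mul, act_loxMatrix_mul_I]
  · congr 1; ext i; fin_cases i <;> simp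
  · congr 1; ext i; fin_cases i <;> simp
  · apply act_add_smul; ext i; fin_cases i <;> simp
  · apply act_add_smul; ext i; fin_cases i <;> simp

theorem spinTranslate_mul (A : SL2C) (ρ : ℝ) : SpinTranslate ρ A (A * loxMatrix ρ) :=
  ⟨fun t => A * loxMatrix ((t * ρ : ℝ) : ℂ),
    continuous_const.mul (continuous_loxMatrix.comp
      (Complex.continuous_ofReal.comp (continuous_mul_const ρ))),
    fun t => spinProj_mul_loxMatrix_ofReal A (t * ρ), by simp [loxMatrix_zero], by simp⟩

theorem spinRotateFirst_mul (A : SL2C) (θ : ℝ) :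
    SpinRotateFirst θ A (A * loxMatrix (θ * Complex.I)) :=
  ⟨fun t => A * loxMatrix (((t * θ : ℝ) : ℂ) * Complex.I),
    continuous_const.mul (continuous_loxMatrix.comp
      ((Complex.continuous_ofReal.comp (continuous_mul_const θ)).mul continuous_const)),
    fun t => spinProj_mul_loxMatrix_mul_I A (t * θ), by simp [loxMatrix_zero], by simp⟩

/-- Right multiplication by `loxMatrix` gives explicit lifts of both the translation and the
rotation; by uniqueness of lifts these are the only ones. -/
theorem isComplexDistance_iff {s₁ s₂ : SL2C} {d : ℂ} :
    IsComplexDistance s₁ s₂ d ↔ s₂ = s₁ * loxMatrix d := by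
  have hd : loxMatrix d = loxMatrix d.re * loxMatrix (d.im * Complex.I) := by
    rw [← loxMatrix_add, Complex.re_add_im]
  rw [hd, ← mul_assoc]
  constructor
  · rintro ⟨s, h₁, h₂⟩
    obtain rfl := h₁.unique (spinTranslate_mul s₁ d.re)
    exact h₂.unique (spinRotateFirst_mul _ d.im)
  · rintro rfl
    exact ⟨_, spinTranslate_mul _ _, spinRotateFirst_mul _ _⟩

/-! ### Lambda lengths of spinors -/

/-- `A A*` is the sum of the rank-one matrices of the two columns. The base point of a spin frame
thus lies on the geodesic between the ideal points of its columns. -/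
theorem act_e0_eq (A : SL2C) : act A ![1, 0, 0, 0] =
    (1 / 2 : ℝ) • spinorNormal (fun r => A r 0) + (1 / 2 : ℝ) • spinorNormal (fun r => A r 1) := by
  apply toHermitian_injective
  rw [toHermitian_act, toHermitian_e0, toHermitian_add, toHermitian_smul, toHermitian_smul,
    toHermitian_spinorNormal, toHermitian_spinorNormal]
  ext i j
  simp [Matrix.mul_apply, Fin.sum_univ_two, vecMulVec_apply]
  ring

theorem spinorNormal_smul (c : ℂ) (κ : Fin 2 → ℂ) :
    spinorNormal (c • κ) = Complex.normSq c • spinorNormal κ := by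
  apply toHermitian_injective
  rw [toHermitian_smul, toHermitian_spinorNormal, toHermitian_spinorNormal]
  ext i j
  simp [vecMulVec_apply, Complex.normSq_eq_conj_mul_self]
  ring

/-- Points of a horosphere can be produced by writing down a matrix of determinant one with first
column `κ`: the point is the image of the base point. -/
theorem exists_spinSL_eq (A : SL2C) {κ : Fin 2 → ℂ} (hA : ∀ r, A r 0 = κ r) :
    ∃ q : horosphereOf (spinorNormal κ), spinSL κ q = A := by
  have hk : (A : Matrix (Fin 2) (Fin 2) ℂ) *ᵥ ![1, 0] = κ := by
    ext r
    rw [← hA r]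
    simp [Matrix.mulVec, dotProduct, Fin.sum_univ_two]
  have h0 : (![1, 0, 0, 0] : Minkowski) ∈ horosphereOf (spinorNormal ![1, 0]) := by
    rw [spinorNormal_one_zero]
    simp [horosphereOf, hyperboloid, minkInner]
  have hq := act_horosphere_subset A ![1, 0] (Set.mem_image_of_mem _ h0)
  rw [hk] at hq
  refine ⟨⟨_, hq⟩, Subtype.ext ?_⟩
  have h := spinMatrix_of_SL A
  rwa [hk] at h

/-- Rotation by `π` swaps the columns up to sign, `(a, b) ↦ (b, -a)`, and the loxodromic factor
rescales them by `exp (±d/2)`. -/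
theorem mul_rot_lox_apply (A : SL2C) (d : ℂ) (r : Fin 2) :
    (A * rotMatrix Real.pi * loxMatrix d) r 0 = Complex.exp (d / 2) * A r 1 ∧
    (A * rotMatrix Real.pi * loxMatrix d) r 1 = -(Complex.exp (-(d / 2)) * A r 0) := by
  rw [Matrix.SpecialLinearGroup.coe_mul, Matrix.SpecialLinearGroup.coe_mul]
  constructor <;>
  simp [rotMatrix, loxMatrix, Matrix.mul_apply, Fin.sum_univ_two] <;> ring

/-- `κ₂` is `exp (d/2)` times the second column of a matrix of determinant one whose first column is
`κ₁`. -/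
theorem IsLambdaLength.eq_det {κ₁ κ₂ : {κ : Fin 2 → ℂ // κ ≠ 0}} {l : ℂ}
    (hc : (spinLift κ₁).centre ≠ (spinLift κ₂).centre)
    (h : IsLambdaLength (spinLift κ₁) (spinLift κ₂) l) :
    l = κ₁.1 0 * κ₂.1 1 - κ₂.1 0 * κ₁.1 1 := by
  rcases h with h | ⟨-, q₁, q₂, d, -, -, h, rfl⟩
  · exact absurd h.1 hc
  rw [isComplexDistance_iff] at h
  change spinSL κ₂ q₂ = spinSL κ₁ q₁ * rotMatrix Real.pi * loxMatrix d at h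
  have k0 : κ₂.1 0 = Complex.exp (d / 2) * spinSL κ₁ q₁ 0 1 := by
    rw [← (mul_rot_lox_apply _ d 0).1, ← h]; rfl
  have k1 : κ₂.1 1 = Complex.exp (d / 2) * spinSL κ₁ q₁ 1 1 := by
    rw [← (mul_rot_lox_apply _ d 1).1, ← h]; rfl
  have hd := (spinSL κ₁ q₁).det_coe
  rw [det_fin_two] at hd
  change κ₁.1 0 * _ - _ * κ₁.1 1 = 1 at hd
  rw [k0, k1]
  linear_combination -Complex.exp (d / 2) * hd

theorem isLambdaLength_det {κ₁ κ₂ : {κ : Fin 2 → ℂ // κ ≠ 0}}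
    (hc : (spinLift κ₁).centre ≠ (spinLift κ₂).centre)
    (hD : κ₁.1 0 * κ₂.1 1 - κ₂.1 0 * κ₁.1 1 ≠ 0) :
    IsLambdaLength (spinLift κ₁) (spinLift κ₂) (κ₁.1 0 * κ₂.1 1 - κ₂.1 0 * κ₁.1 1) := by
  obtain ⟨D, hD'⟩ : ∃ D, D = κ₁.1 0 * κ₂.1 1 - κ₂.1 0 * κ₁.1 1 := ⟨_, rfl⟩
  rw [← hD'] at hD ⊢
  -- The frame of the first horosphere on the common geodesic: its second column must be
  -- proportional to `κ₂`, and determinant one fixes the factor `D⁻¹`.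
  let A : SL2C := ⟨!![κ₁.1 0, D⁻¹ * κ₂.1 0; κ₁.1 1, D⁻¹ * κ₂.1 1], by
    rw [det_fin_two_of]; field_simp; rw [hD']⟩
  have hexp : Complex.exp (2 * Complex.log D / 2) = D := by
    rw [mul_div_cancel_left₀ _ two_ne_zero, Complex.exp_log hD]
  -- Translating by `2 log D` makes the first column `κ₂` and the second `-D⁻¹ κ₁`, so `B` lies over
  -- the point of the second horosphere on the same geodesic.
  let B : SL2C := A * rotMatrix Real.pi * loxMatrix (2 * Complex.log D)
  have B0 (r) : B r 0 = κ₂.1 r := by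
    rw [(mul_rot_lox_apply A _ r).1, hexp]
    fin_cases r <;> simp [A] <;> field_simp
  have B1 (r) : B r 1 = ((-D⁻¹) • κ₁.1) r := by
    rw [(mul_rot_lox_apply A _ r).2, Complex.exp_neg, hexp]
    fin_cases r <;> simp [A]
  have A0 (r) : A r 0 = κ₁.1 r := by fin_cases r <;> rfl
  have A1 (r) : A r 1 = (D⁻¹ • κ₂.1) r := by fin_cases r <;> rfl
  obtain ⟨q₁, h₁⟩ := exists_spinSL_eq A A0
  obtain ⟨q₂, h₂⟩ := exists_spinSL_eq B B0
  have n₁ : (spinLift κ₁).normal = spinorNormal κ₁ := spinorHorosphere_normal κ₁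
  have n₂ : (spinLift κ₂).normal = spinorNormal κ₂ := spinorHorosphere_normal κ₂
  have hN : 0 < Complex.normSq D⁻¹ := Complex.normSq_pos.mpr (inv_ne_zero hD)
  refine Or.inr ⟨hc, q₁, q₂, 2 * Complex.log D, ?_, ?_, ?_, hexp.symm⟩
  · refine ⟨q₁.2.1, 1 / 2, 1 / 2 * Complex.normSq D⁻¹, by positivity, by positivity, ?_⟩
    rw [n₁, n₂, ← act_spinSL, h₁, act_e0_eq, funext A0, funext A1, mul_smul]
    rw [spinorNormal_smul]
  · refine ⟨q₂.2.1, 1 / 2 * Complex.normSq D⁻¹, 1 / 2, by positivity, by positivity, ?_⟩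
    rw [n₁, n₂, ← act_spinSL, h₂, act_e0_eq, funext B0, funext B1, mul_smul]
    rw [spinorNormal_smul, Complex.normSq_neg, add_comm]
  · rw [isComplexDistance_iff]
    change spinSL κ₂ q₂ = spinSL κ₁ q₁ * rotMatrix Real.pi * loxMatrix _
    rw [h₁, h₂]

/-! ### Fields specified by `i` -/

theorem fderiv_toUpper {x : Minkowski} (hx : x 0 - x 3 ≠ 0) (v : Minkowski) :
    fderiv ℝ toUpper x v =
      ((((v 1 : ℂ) + Complex.I * v 2) * (x 0 - x 3) - (x 1 + Complex.I * x 2) * (v 0 - v 3)) /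
        ((x 0 : ℂ) - x 3) ^ 2, -(v 0 - v 3) / (x 0 - x 3) ^ 2) := by
  have hx' : (x 0 : ℂ) - x 3 ≠ 0 := by exact_mod_cast hx
  have hc (i : Fin 4) : DifferentiableAt ℝ (fun y : Minkowski => ((y i : ℝ) : ℂ)) x :=
    Complex.ofRealCLM.differentiableAt.comp x (differentiableAt_apply i x)
  have hr (i : Fin 4) : DifferentiableAt ℝ (fun y : Minkowski => y i) x :=
    differentiableAt_apply i x
  have hdiff : DifferentiableAt ℝ toUpper x := by
    refine DifferentiableAt.prodMk ?_ ?_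
    · have h := ((hc 1).fun_add ((hc 2).const_mul Complex.I)).fun_mul
        (((hc 0).fun_sub (hc 3)).fun_inv hx')
      exact h
    · have h := (differentiableAt_const (1 : ℝ)).fun_mul (((hr 0).fun_sub (hr 3)).fun_inv hx)
      exact h
  -- Once `toUpper` is known to be differentiable, its derivative in the direction `v` follows from
  -- the quotient rule along `t ↦ x + t v`.
  rw [← hdiff.lineDeriv_eq_fderiv]
  apply HasDerivAt.deriv
  have lr (i : Fin 4) : HasDerivAt (fun t : ℝ => (x + t • v) i) (v i) 0 := by
    simpa using ((hasDerivAt_id (0 : ℝ)).mul_const (v i)).const_add (x i)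
  have lc (i : Fin 4) : HasDerivAt (fun t : ℝ => (((x + t • v) i : ℝ) : ℂ)) (v i) 0 :=
    (lr i).ofReal_comp
  have z0 (i : Fin 4) : (x + (0 : ℝ) • v) i = x i := by simp
  refine HasDerivAt.prodMk ?_ ?_
  · have h := ((lc 1).fun_add ((lc 2).const_mul Complex.I)).fun_div ((lc 0).fun_sub (lc 3))
      (by simpa using hx')
    simp only [z0] at h
    exact h
  · have h := (hasDerivAt_const (0 : ℝ) (1 : ℝ)).fun_div ((lr 0).fun_sub (lr 3)) (by simpa using hx)
    simp only [z0, zero_mul, one_mul, zero_sub] at h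
    exact h

theorem hyperboloid_sub_pos {q : Minkowski} (hq : q ∈ hyperboloid) : 0 < q 0 - q 3 := by
  obtain ⟨h0, h⟩ := hq
  simp only [minkInner] at h
  nlinarith [sq_nonneg (q 1), sq_nonneg (q 2)]

theorem Horosphere.mem_hyperboloid (h : Horosphere) (q : h.carrier) :
    (q : Minkowski) ∈ hyperboloid := by
  obtain ⟨p, -, hp⟩ := h.exists_normal
  exact (hp ▸ q.2 : (q : Minkowski) ∈ horosphereOf p).1

/-- The height is `1 / (T - Z)`, so highest points minimise `T - Z`. A horizontal vector has `V 0 =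
V 3`, which leaves `V 1 + i V 2`, up to a positive factor, as its horizontal part. -/
theorem Horosphere.isSpecifiedBy_I_iff (h : Horosphere) (V : h.carrier → Minkowski) :
    h.IsSpecifiedBy V Complex.I ↔ ∀ q : h.carrier,
      (∀ q' : h.carrier, (q : Minkowski) 0 - (q : Minkowski) 3 ≤
        (q' : Minkowski) 0 - (q' : Minkowski) 3) → V q 0 = V q 3 ∧ V q 1 = 0 ∧ 0 < V q 2 := by
  refine forall_congr' fun q => imp_congr (forall_congr' fun q' => ?_) ?_
  · exact one_div_le_one_div (hyperboloid_sub_pos (h.mem_hyperboloid q'))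
      (hyperboloid_sub_pos (h.mem_hyperboloid q))
  · have hs := hyperboloid_sub_pos (h.mem_hyperboloid q)
    have hs' : ((q : Minkowski) 0 : ℂ) - (q : Minkowski) 3 ≠ 0 := by exact_mod_cast hs.ne'
    rw [fderiv_toUpper hs.ne']
    simp only [Prod.mk.injEq, div_eq_zero_iff, pow_eq_zero_iff two_ne_zero, hs.ne', or_false,
      neg_eq_zero, sub_eq_zero]
    constructor
    · rintro ⟨c, hc, h1, h2⟩
      rw [h2, sub_self, mul_zero, sub_zero, div_eq_iff (pow_ne_zero 2 hs')] at h1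
      have h1 : (V q 1 : ℂ) + Complex.I * V q 2 =
          c * Complex.I * ((q : Minkowski) 0 - (q : Minkowski) 3) := by
        apply mul_right_cancel₀ hs'
        rw [h1]; ring
      have e1 := congrArg Complex.re h1
      have e2 := congrArg Complex.im h1
      simp at e1 e2
      exact ⟨h2, e1, by rw [e2]; positivity⟩
    · rintro ⟨h2, h1, h3⟩
      refine ⟨V q 2 / ((q : Minkowski) 0 - (q : Minkowski) 3), by positivity, ?_, h2⟩
      rw [h2, h1]
      push_cast
      field_simp
      simp

theorem act_e0_sub (A : SL2C) : act A ![1, 0, 0, 0] 0 - act A ![1, 0, 0, 0] 3 =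
    Complex.normSq (A 1 0) + Complex.normSq (A 1 1) := by
  simp [act, ofHermitian, toHermitian, Matrix.mul_apply, Fin.sum_univ_two, Complex.normSq_apply]
  ring

/-- The bottom-left entry is constant along the horosphere, so highest points are those where the
bottom-right entry has least modulus. -/
theorem horosphere_sub (κ : Fin 2 → ℂ) (q : horosphereOf (spinorNormal κ)) :
    (q : Minkowski) 0 - (q : Minkowski) 3 =
      Complex.normSq (κ 1) + Complex.normSq (spinSL κ q 1 1) := by
  have := act_e0_sub (spinSL κ q)
  rwa [act_spinSL] at this

/-- A real vector as a spinor. -/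
def realSpinor (v : Fin 2 → ℝ) : Fin 2 → ℂ := fun r => v r

theorem realSpinor_injective : Function.Injective realSpinor := by
  intro v w h
  funext r
  have := congrFun h r
  simpa [realSpinor] using this

theorem realSpinor_ne_zero {v : Fin 2 → ℝ} (hv : v ≠ 0) : realSpinor v ≠ 0 := by
  intro h
  apply hv
  apply realSpinor_injective
  rw [h]; funext r; simp [realSpinor]

theorem spinSL_det (κ : Fin 2 → ℂ) (q : horosphereOf (spinorNormal κ)) :
    κ 0 * spinSL κ q 1 1 - spinSL κ q 0 1 * κ 1 = 1 := by
  have hd := (spinSL κ q).det_coe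
  rwa [det_fin_two] at hd

/-- A highest point of the horosphere of a real spinor. -/
theorem exists_highest {v : Fin 2 → ℝ} (hv : v ≠ 0) :
    ∃ q : horosphereOf (spinorNormal (realSpinor v)),
      (v 1 ≠ 0 → spinSL (realSpinor v) q 1 1 = 0) ∧
      ∀ q' : horosphereOf (spinorNormal (realSpinor v)),
        (q : Minkowski) 0 - (q : Minkowski) 3 ≤ (q' : Minkowski) 0 - (q' : Minkowski) 3 := by
  by_cases h1 : v 1 = 0
  · have h0 : v 0 ≠ 0 := fun h0 => hv (by ext i; fin_cases i <;> assumption)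
    have h0' : (v 0 : ℂ) ≠ 0 := by exact_mod_cast h0
    obtain ⟨q, -⟩ := exists_spinSL_eq (κ := realSpinor v)
      ⟨!![(v 0 : ℂ), 0; 0, (v 0 : ℂ)⁻¹], by rw [det_fin_two_of]; field_simp; simp⟩
      (by intro r; fin_cases r <;> simp [realSpinor, h1])
    refine ⟨q, fun h => absurd h1 h, fun q' => le_of_eq ?_⟩
    -- With centre `∞`, determinant one fixes the bottom-right entry: the horosphere is a horizontal
    -- plane and all its points are highest.
    have key (q) : spinSL (realSpinor v) q 1 1 = (v 0 : ℂ)⁻¹ := by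
      have := spinSL_det (realSpinor v) q
      simp only [realSpinor, h1] at this
      apply mul_left_cancel₀ h0'
      rw [mul_inv_cancel₀ h0']
      simpa using this
    rw [horosphere_sub, horosphere_sub, key, key]
  · have h1' : (v 1 : ℂ) ≠ 0 := by exact_mod_cast h1
    -- With finite centre the bottom-right entry can vanish; this is the north pole.
    obtain ⟨q, hq⟩ := exists_spinSL_eq (κ := realSpinor v)
      ⟨!![(v 0 : ℂ), -(v 1 : ℂ)⁻¹; (v 1 : ℂ), 0], by rw [det_fin_two_of]; field_simp; simp⟩
      (by intro r; fin_cases r <;> simp [realSpinor])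
    have hz : spinSL (realSpinor v) q 1 1 = 0 := by rw [hq]; simp
    refine ⟨q, fun _ => hz, fun q' => ?_⟩
    rw [horosphere_sub, horosphere_sub, hz]
    simpa using Complex.normSq_nonneg _

/-- At a north pole the frame matrix is real, and real matrices fix the normal direction `Y` to the
plane `Y = 0`. If the centre is `∞`, it is upper triangular with real diagonal, which only adds
equal `T` and `Z` components to that direction. -/
theorem spinLift_realSpinor_isSpecifiedBy {v : Fin 2 → ℝ} (hv : v ≠ 0) :
    (spinorHorosphere ⟨realSpinor v, realSpinor_ne_zero hv⟩).IsSpecifiedBy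
      (spinLift ⟨realSpinor v, realSpinor_ne_zero hv⟩).direction Complex.I := by
  refine (Horosphere.isSpecifiedBy_I_iff _ _).mpr fun q hq => ?_
  obtain ⟨q₀, h₀, -⟩ := exists_highest hv
  have hle := hq q₀
  have e : ((q : Minkowski) 0 - (q : Minkowski) 3) = _ := horosphere_sub (realSpinor v) q
  rw [e, horosphere_sub (realSpinor v) q₀] at hle
  have hd := spinSL_det (realSpinor v) q
  change act (spinSL (realSpinor v) q) _ 0 = act (spinSL (realSpinor v) q) _ 3 ∧
    act (spinSL (realSpinor v) q) _ 1 = 0 ∧ 0 < act (spinSL (realSpinor v) q) _ 2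
  have c0 : spinSL (realSpinor v) q 0 0 = v 0 := rfl
  have c1 : spinSL (realSpinor v) q 1 0 = v 1 := rfl
  have hz : v 1 ≠ 0 → spinSL (realSpinor v) q 1 1 = 0 := by
    intro h
    rw [h₀ h] at hle
    simp only [map_zero, add_zero, add_le_iff_nonpos_right] at hle
    exact Complex.normSq_eq_zero.mp (le_antisymm hle (Complex.normSq_nonneg _))
  simp only [act]
  generalize spinSL (realSpinor v) q = A at *
  have hr := congrArg Complex.re hd
  have hi := congrArg Complex.im hd
  simp [realSpinor] at hr hi
  simp [ofHermitian, toHermitian, Matrix.mul_apply, Fin.sum_univ_two, c0, c1]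
  by_cases h1 : v 1 = 0
  · simp only [h1] at hr hi ⊢
    refine ⟨?_, ?_, ?_⟩ <;> linarith
  · have := hz h1
    simp only [this] at hr hi ⊢
    simp at hr hi ⊢
    have hi := hi.resolve_right h1
    rw [hi]
    exact ⟨Or.inl rfl, by linarith⟩

/-! ### Centres -/

/-- The point of `ℝ ∪ {∞}` with homogeneous coordinates `v`. -/
noncomputable def ratio (v : Fin 2 → ℝ) : OnePoint ℝ :=
  if v 1 = 0 then ∞ else ((v 0 / v 1 : ℝ) : OnePoint ℝ)

theorem spinorNormal_realSpinor (v : Fin 2 → ℝ) : spinorNormal (realSpinor v) =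
    ![v 0 ^ 2 + v 1 ^ 2, 2 * (v 0 * v 1), 0, v 0 ^ 2 - v 1 ^ 2] := by
  ext i
  fin_cases i <;> simp [spinorNormal, realSpinor, ofHermitian, vecMulVec_apply] <;> ring

theorem spinLift_realSpinor_centre {v : Fin 2 → ℝ} (hv : v ≠ 0) :
    (spinLift ⟨realSpinor v, realSpinor_ne_zero hv⟩).centre = (ratio v).map ((↑) : ℝ → ℂ) := by
  have hn : (spinLift ⟨realSpinor v, realSpinor_ne_zero hv⟩).normal =
    spinorNormal (realSpinor v) := spinorHorosphere_normal _
  rw [Horosphere.centre, hn, spinorNormal_realSpinor, ratio]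
  by_cases h1 : v 1 = 0
  · simp [h1]
  · have h1' : (v 1 : ℂ) ≠ 0 := by exact_mod_cast h1
    rw [if_neg, if_neg h1, OnePoint.map_some]
    · congr 1
      simp
      field_simp
      ring
    · simp
      intro h
      apply h1
      have : v 1 ^ 2 = 0 := by linarith
      simpa using this

theorem spinLift_realSpinor_isPlanarAt {v : Fin 2 → ℝ} (hv : v ≠ 0) :
    (spinLift ⟨realSpinor v, realSpinor_ne_zero hv⟩).IsPlanarAt (ratio v) :=
  ⟨spinLift_realSpinor_centre hv, spinLift_realSpinor_isSpecifiedBy hv⟩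

/-! ### Planar spin decorations come from real spinors -/

theorem Horosphere.normal_mem (h : Horosphere) : h.normal ∈ lightCone :=
  h.exists_normal.choose_spec.1

theorem Horosphere.carrier_eq (h : Horosphere) : h.carrier = horosphereOf h.normal :=
  h.exists_normal.choose_spec.2

theorem Horosphere.normal_two_eq_zero {h : Horosphere} {z : OnePoint ℝ}
    (hz : h.centre = z.map ((↑) : ℝ → ℂ)) : h.normal 2 = 0 := by
  obtain ⟨h0, hm⟩ := h.normal_mem
  simp only [minkInner] at hm
  rw [Horosphere.centre] at hz
  split_ifs at hz with he
  · rw [he] at hm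
    nlinarith [sq_nonneg (h.normal 1), sq_nonneg (h.normal 2)]
  · induction z using OnePoint.rec with
    | infty => exact absurd hz (by simp)
    | coe x =>
      rw [OnePoint.map_some, OnePoint.coe_eq_coe] at hz
      have hne : (h.normal 0 : ℂ) - h.normal 3 ≠ 0 := by
        rw [sub_ne_zero]; exact_mod_cast he
      rw [div_eq_iff hne] at hz
      simpa using congrArg Complex.im hz

/-- The Hermitian matrix of `p` is real symmetric, positive and of rank one, hence of the form `v
vᵀ`. -/
theorem exists_realSpinor_normal {p : Minkowski} (hp : p ∈ lightCone) (h2 : p 2 = 0) :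
    ∃ v : Fin 2 → ℝ, v ≠ 0 ∧ spinorNormal (realSpinor v) = p := by
  obtain ⟨h0, hm⟩ := hp
  simp only [minkInner, h2] at hm
  suffices ∃ v : Fin 2 → ℝ, spinorNormal (realSpinor v) = p by
    obtain ⟨v, hv⟩ := this
    refine ⟨v, ?_, hv⟩
    rintro rfl
    rw [← hv, spinorNormal_realSpinor] at h0
    simp at h0
  by_cases he : p 0 = p 3
  · have h1 : p 1 = 0 := by rw [he] at hm; simpa using hm
    refine ⟨![√(p 0), 0], ?_⟩
    rw [spinorNormal_realSpinor]
    ext i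
    fin_cases i <;> simp [Real.sq_sqrt h0.le, h1, h2, ← he]
  · have hpos : 0 < (p 0 - p 3) / 2 := by
      have : p 3 ≤ p 0 := by nlinarith [sq_nonneg (p 1)]
      have := lt_of_le_of_ne this (Ne.symm he)
      linarith
    have hs := Real.sq_sqrt hpos.le
    have hs0 := (Real.sqrt_pos.mpr hpos).ne'
    -- The solution of `2 (v 1)² = T - Z` and `2 v 0 v 1 = X` with `v 1 > 0`.
    refine ⟨![p 1 / (2 * √((p 0 - p 3) / 2)), √((p 0 - p 3) / 2)], ?_⟩
    rw [spinorNormal_realSpinor]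
    generalize √((p 0 - p 3) / 2) = s at *
    have hp0 : p 0 = p 3 + 2 * s ^ 2 := by linarith
    have hp1 : p 1 ^ 2 = 4 * s ^ 2 * (p 3 + s ^ 2) := by
      rw [hp0] at hm; linarith
    have hq : (p 1 / (2 * s)) ^ 2 = p 3 + s ^ 2 := by
      rw [div_pow, hp1]; field_simp; ring
    ext i
    fin_cases i <;> simp only [Fin.zero_eta, Fin.mk_one, Fin.reduceFinMk, cons_val, cons_val_zero,
      cons_val_one]
    · rw [hq, hp0]; ring
    · field_simp
    · exact h2.symm
    · rw [hq]; ring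

/-- The parabolic isometries preserving a horosphere act transitively on it. -/
theorem exists_parabolic (κ : Fin 2 → ℂ) (q q' : horosphereOf (spinorNormal κ)) :
    ∃ A : SL2C, IsParabolic A ∧ act A '' horosphereOf (spinorNormal κ) =
      horosphereOf (spinorNormal κ) ∧ (q' : Minkowski) = act A q := by
  -- Both matrices have first column `κ`, so the quotient fixes `κ`; both have determinant one, so
  -- its trace is `2`.
  refine ⟨spinSL κ q' * (spinSL κ q)⁻¹, ?_, ?_, ?_⟩
  · left
    have d := spinSL_det κ q
    have d' := spinSL_det κ q'
    rw [Matrix.SpecialLinearGroup.coe_mul, Matrix.SpecialLinearGroup.coe_inv, adjugate_fin_two,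
      trace_fin_two]
    simp only [Matrix.mul_apply, Fin.sum_univ_two, of_apply, cons_val', cons_val_zero,
      cons_val_one, cons_val_fin_one]
    have c0 (q) : spinSL κ q 0 0 = κ 0 := rfl
    have c1 (q) : spinSL κ q 1 0 = κ 1 := rfl
    rw [c0, c1, c0, c1]
    linear_combination d + d'
  · have h : (↑(spinSL κ q)⁻¹ : Matrix (Fin 2) (Fin 2) ℂ) *ᵥ κ = ![1, 0] := by
      have e := congrArg (fun u => (↑(spinSL κ q)⁻¹ : Matrix (Fin 2) (Fin 2) ℂ) *ᵥ u)
        (spinSL_mulVec κ q)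
      rw [← e]
      change _ *ᵥ (_ *ᵥ _) = _
      rw [Matrix.mulVec_mulVec, ← Matrix.SpecialLinearGroup.coe_mul, inv_mul_cancel,
        Matrix.SpecialLinearGroup.coe_one, Matrix.one_mulVec]
    rw [act_horosphere, Matrix.SpecialLinearGroup.coe_mul, ← Matrix.mulVec_mulVec, h,
      spinSL_mulVec]
  · conv_rhs => rw [← act_spinSL κ q]
    rw [← act_mul, inv_mul_cancel_right, act_spinSL]

/-- A parallel unit field specified by `i` is unique. -/
theorem Horosphere.IsUnitParallel.eq_of_isSpecifiedBy {h : Horosphere}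
    {V V' : h.carrier → Minkowski} (hV : h.IsUnitParallel V) (hV' : h.IsUnitParallel V')
    (hI : h.IsSpecifiedBy V Complex.I) (hI' : h.IsSpecifiedBy V' Complex.I)
    {q : h.carrier} (hq : ∀ q' : h.carrier, (q : Minkowski) 0 - (q : Minkowski) 3 ≤
      (q' : Minkowski) 0 - (q' : Minkowski) 3)
    (ht : ∀ q' : h.carrier, ∃ A : SL2C, IsParabolic A ∧ act A '' h.carrier = h.carrier ∧
      (q' : Minkowski) = act A q) : V = V' := by
  rw [Horosphere.isSpecifiedBy_I_iff] at hI hI'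
  -- No freedom remains at a highest point: unit length and `U q 2 > 0` give `U q 2 = 1`, and
  -- tangency at `q` then determines `U q 0 = U q 3`.
  have key : ∀ {U}, h.IsUnitParallel U → (U q 0 = U q 3 ∧ U q 1 = 0 ∧ 0 < U q 2) →
      U q = ![(q : Minkowski) 2 / ((q : Minkowski) 0 - (q : Minkowski) 3), 0, 1,
        (q : Minkowski) 2 / ((q : Minkowski) 0 - (q : Minkowski) 3)] := by
    rintro U hU ⟨u0, u1, u2⟩
    have hs := hyperboloid_sub_pos (h.mem_hyperboloid q)
    have hu := hU.unit q
    have e2 : U q 2 = 1 := by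
      simp only [minkInner, u0, u1] at hu
      nlinarith
    have t := hU.tangent_hyperboloid q
    simp only [minkInner, u0, u1, e2] at t
    have e3 : U q 3 = (q : Minkowski) 2 / ((q : Minkowski) 0 - (q : Minkowski) 3) := by
      rw [eq_div_iff hs.ne']; linarith
    ext i
    fin_cases i <;> simp [u0, u1, e2, e3]
  have hqq : V q = V' q := (key hV (hI q hq)).trans (key hV' (hI' q hq)).symm
  funext q'
  obtain ⟨A, hA, hA', hq'⟩ := ht q'
  rw [hV.parallel A hA hA' q q' hq', hV'.parallel A hA hA' q q' hq', hqq]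

/-- Matrices of determinant one with the same first column differ by adding a multiple `t` of it to
the second column, so the horosphere is a continuous image of `ℂ`. Connectedness is what makes the
sign of a lift global. -/
theorem preconnectedSpace_horosphereOf (κ : Fin 2 → ℂ) :
    PreconnectedSpace (horosphereOf (spinorNormal κ)) := by
  rcases isEmpty_or_nonempty (horosphereOf (spinorNormal κ)) with h | ⟨⟨q⟩⟩
  · infer_instance
  obtain ⟨B, hB⟩ : ∃ B : Matrix (Fin 2) (Fin 2) ℂ, B = spinSL κ q := ⟨_, rfl⟩
  have d := spinSL_det κ q
  rw [← hB] at d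
  have c0 : B 0 0 = κ 0 := by rw [hB]; rfl
  have c1 : B 1 0 = κ 1 := by rw [hB]; rfl
  let f : ℂ → Minkowski := fun t => (1 / 2 : ℝ) • spinorNormal κ +
    (1 / 2 : ℝ) • spinorNormal (fun r => B r 1 + t * B r 0)
  have hf : Continuous f := by
    refine continuous_const.add (Continuous.fun_const_smul ?_ _)
    refine continuous_pi fun i => ?_
    fin_cases i <;> simp [spinorNormal, ofHermitian, vecMulVec_apply] <;> fun_prop
  have hr : Set.range f = horosphereOf (spinorNormal κ) := by
    ext p
    constructor
    · rintro ⟨t, rfl⟩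
      obtain ⟨q', hq'⟩ := exists_spinSL_eq (κ := κ)
        ⟨!![κ 0, B 0 1 + t * κ 0; κ 1, B 1 1 + t * κ 1], by
          rw [det_fin_two_of]; linear_combination d⟩ (by intro r; fin_cases r <;> rfl)
      convert q'.2 using 1
      rw [← act_spinSL κ q', act_e0_eq, hq']
      simp only [f]
      congr 3
      · ext r; fin_cases r <;> rfl
      · ext r; fin_cases r <;> simp [c0, c1]
    · intro hp
      have d' := spinSL_det κ ⟨p, hp⟩
      have hC := act_spinSL κ ⟨p, hp⟩
      have b0 : spinSL κ ⟨p, hp⟩ 0 0 = κ 0 := rfl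
      have b1 : spinSL κ ⟨p, hp⟩ 1 0 = κ 1 := rfl
      rw [act_e0_eq] at hC
      generalize spinSL κ ⟨p, hp⟩ = C at *
      simp only at hC
      -- Cramer's rule for `t`: the determinant of the second columns of `C` and `B`.
      refine ⟨B 1 1 * C 0 1 - B 0 1 * C 1 1, ?_⟩
      rw [← hC]
      simp only [f]
      congr 3
      · ext r
        fin_cases r
        · exact b0.symm
        · exact b1.symm
      · ext r
        fin_cases r
        · simp only [Fin.zero_eta, c0]
          linear_combination C.1 0 1 * d - B 0 1 * d'
        · simp only [Fin.mk_one, c1]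
          linear_combination C.1 1 1 * d - B 1 1 * d'
  rw [← isPreconnected_iff_preconnectedSpace, ← hr]
  exact isPreconnected_range hf

/-- The inward decoration is a spin rotation of the outward one, and such rotations have a unique
result. Points are compared in Minkowski space because the two carriers have different types until
the horospheres are identified. -/
theorem eq_spinLift_of_wout_eq {κ : {κ : Fin 2 → ℂ // κ ≠ 0}} {w : SpinDecoratedHorosphere}
    (h : w.toHorosphere = spinorHorosphere κ)
    (hw : ∀ (q : w.carrier) (q' : (spinorHorosphere κ).carrier), (q : Minkowski) = q' →
      w.wout q = spinSL κ q') : spinLift κ = w := by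
  obtain ⟨H, win, wout, c, c', V, hV, i, o, r, r'⟩ := w
  dsimp only at h
  subst h
  obtain rfl : wout = fun q => spinSL κ q := funext fun q => hw q q rfl
  obtain rfl : win = fun q => spinSL κ q * rotMatrix Real.pi :=
    funext fun q => (r q).unique (spinRotateSecond_mul _ _)
  rfl

theorem spinSL_neg (κ : Fin 2 → ℂ) (q : Minkowski) (h : q ∈ horosphereOf (spinorNormal κ))
    (h' : q ∈ horosphereOf (spinorNormal (-κ))) : spinSL (-κ) ⟨q, h'⟩ = -spinSL κ ⟨q, h⟩ :=
  Subtype.ext (by rw [Matrix.SpecialLinearGroup.coe_neg]; exact spinMatrix_neg κ q)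

/-- Every planar spin decoration has a real spin vector. -/
theorem exists_realSpinor_of_isPlanarAt {w : SpinDecoratedHorosphere} {z : OnePoint ℝ}
    (hw : w.IsPlanarAt z) : ∃ (v : Fin 2 → ℝ) (hv : v ≠ 0),
      spinLift ⟨realSpinor v, realSpinor_ne_zero hv⟩ = w := by
  obtain ⟨hz, hI⟩ := hw
  obtain ⟨v, hv, hn⟩ := exists_realSpinor_normal w.normal_mem (Horosphere.normal_two_eq_zero hz)
  have hc : w.carrier = horosphereOf (spinorNormal (realSpinor v)) := by rw [hn]; exact w.carrier_eq
  have hH : w.toHorosphere = spinorHorosphere ⟨realSpinor v, realSpinor_ne_zero hv⟩ := by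
    generalize w.toHorosphere = H at hc
    cases H
    dsimp only at hc
    subst hc
    rfl
  have hneg : spinorNormal (-realSpinor v) = spinorNormal (realSpinor v) := by
    have := spinorNormal_smul (-1) (realSpinor v)
    simpa using this
  have hvneg : realSpinor (-v) = -realSpinor v := by ext r; simp [realSpinor]
  have hH' : w.toHorosphere =
      spinorHorosphere ⟨realSpinor (-v), realSpinor_ne_zero (neg_ne_zero.mpr hv)⟩ := by
    rw [hH]
    simp only [spinorHorosphere, hvneg, hneg]
  -- The negative lift is handled by `-v`, which has the same normal and opposite frame matrices.
  suffices (∀ (q : w.carrier) (q' : horosphereOf (spinorNormal (realSpinor v))),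
        (q : Minkowski) = q' → w.wout q = spinSL (realSpinor v) q') ∨
      (∀ (q : w.carrier) (q' : horosphereOf (spinorNormal (realSpinor v))),
        (q : Minkowski) = q' → w.wout q = -spinSL (realSpinor v) q') by
    rcases this with h | h
    · exact ⟨v, hv, eq_spinLift_of_wout_eq hH h⟩
    · refine ⟨-v, neg_ne_zero.mpr hv, eq_spinLift_of_wout_eq hH' fun q q' hq => ?_⟩
      obtain ⟨q', hq'⟩ := q'
      change q' ∈ horosphereOf (spinorNormal (realSpinor (-v))) at hq'
      change _ = spinSL (realSpinor (-v)) ⟨q', hq'⟩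
      have hq'' : q' ∈ horosphereOf (spinorNormal (realSpinor v)) := by
        rwa [hvneg, hneg] at hq'
      rw [h q ⟨q', hq''⟩ hq]
      have e : ∀ (κ : Fin 2 → ℂ) (_ : κ = -realSpinor v) (hκ : q' ∈ horosphereOf (spinorNormal κ)),
          -spinSL (realSpinor v) ⟨q', hq''⟩ = spinSL κ ⟨q', hκ⟩ := by
        rintro _ rfl hκ
        rw [spinSL_neg]
      exact e _ hvneg hq'
  clear hH' hvneg hneg hn hz hc
  obtain ⟨H, win, wout, c, c', V, hV, i, o, r, r'⟩ := w
  dsimp only at hH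
  subst hH
  have hVd : (fun q => (spinProj (wout q)).v2) = V := by
    funext q
    rw [o q]; rfl
  change Horosphere.IsSpecifiedBy _ (fun q => (spinProj (wout q)).v2) _ at hI
  rw [hVd] at hI
  obtain ⟨q, -, hq⟩ := exists_highest hv
  -- The given field is the one of `v`, so `wout` and `spinSL` lift the same frames.
  have hVV := Horosphere.IsUnitParallel.eq_of_isSpecifiedBy hV
    (spinorHorosphere_isUnitParallel _) hI (spinLift_realSpinor_isSpecifiedBy hv) (q := q) hq
    (exists_parabolic (realSpinor v) q)
  have := preconnectedSpace_horosphereOf (realSpinor v)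
  have hl := lifts_eq_or_eq_neg (X := horosphereOf (spinorNormal (realSpinor v))) c'
    (continuous_spinSL (realSpinor v)) (fun q => by
      rw [o q, hVV]
      exact (spinProj_spinSL ⟨realSpinor v, realSpinor_ne_zero hv⟩ q).symm)
  rcases hl with h | h
  · left
    intro q q' hq
    obtain rfl := Subtype.ext hq
    exact congrFun h q
  · right
    intro q q' hq
    obtain rfl := Subtype.ext hq
    exact congrFun h q

/-- The set of outward spin frames determines `κ` as their common first column; it is nonempty since
a nonzero vector extends to a matrix of determinant one. -/
theorem spinLift_injective : Function.Injective spinLift := by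
  intro κ κ' h
  have hr := range_spinLift_wout κ
  rw [h, range_spinLift_wout κ'] at hr
  obtain ⟨A, hA⟩ : ∃ A : SL2C, ∀ r, A r 0 = κ.1 r := by
    obtain ⟨κ, hκ⟩ := κ
    by_cases h0 : κ 0 = 0
    · have h1 : κ 1 ≠ 0 := fun h1 => hκ (by ext i; fin_cases i <;> assumption)
      exact ⟨⟨!![κ 0, -(κ 1)⁻¹; κ 1, 0], by rw [det_fin_two_of]; field_simp; simp⟩,
        fun r => by fin_cases r <;> rfl⟩
    · exact ⟨⟨!![κ 0, 0; κ 1, (κ 0)⁻¹], by rw [det_fin_two_of]; field_simp; simp⟩,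
        fun r => by fin_cases r <;> rfl⟩
  have hA' : A ∈ {A : SL2C | ∀ r, A r 0 = κ'.1 r} := by rw [hr]; exact hA
  exact Subtype.ext (funext fun r => (hA r).symm.trans (hA' r))

/-! ### Order of the vertices -/

theorem ratio_eq_iff {v w : Fin 2 → ℝ} (hv : v ≠ 0) (hw : w ≠ 0) :
    ratio v = ratio w ↔ v 0 * w 1 - w 0 * v 1 = 0 := by
  have h0 {u : Fin 2 → ℝ} (hu : u ≠ 0) (h1 : u 1 = 0) : u 0 ≠ 0 := fun h0 =>
    hu (by ext i; fin_cases i <;> assumption)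
  rw [ratio, ratio]
  by_cases h1 : v 1 = 0 <;> by_cases h2 : w 1 = 0
  · simp [h1, h2]
  · simp [h1, h2, h0 hv h1]
  · simp [h1, h2, h0 hw h2]
  · rw [if_neg h1, if_neg h2, OnePoint.coe_eq_coe, div_eq_div_iff h1 h2, sub_eq_zero]

/-- The difference of the ratios is the minor divided by `v 1 * w 1`. If this product vanishes then
`v` represents `∞`, the top of the cut order. -/
theorem cut_ratio_lt_of_nonneg {v w : Fin 2 → ℝ} (hd : 0 < v 0 * w 1 - w 0 * v 1)
    (hw : w 1 ≠ 0) (h : 0 ≤ v 1 * w 1) : cut (ratio w) < cut (ratio v) := by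
  rw [ratio, ratio, if_neg hw]
  by_cases h1 : v 1 = 0
  · rw [if_pos h1]
    exact WithTop.coe_lt_top _
  · rw [if_neg h1]
    refine WithTop.coe_lt_coe.mpr ?_
    have hp : 0 < v 1 * w 1 := lt_of_le_of_ne h (mul_ne_zero h1 hw).symm
    have : v 0 / v 1 - w 0 / w 1 = (v 0 * w 1 - w 0 * v 1) / (v 1 * w 1) := by field_simp
    have := this ▸ div_pos hd hp
    linarith

theorem cut_ratio_lt_of_nonpos {v w : Fin 2 → ℝ} (hd : 0 < v 0 * w 1 - w 0 * v 1)
    (hv : v 1 ≠ 0) (h : v 1 * w 1 ≤ 0) : cut (ratio v) < cut (ratio w) := by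
  rw [ratio, ratio, if_neg hv]
  by_cases h1 : w 1 = 0
  · rw [if_pos h1]
    exact WithTop.coe_lt_top _
  · rw [if_neg h1]
    refine WithTop.coe_lt_coe.mpr ?_
    have hp : v 1 * w 1 < 0 := lt_of_le_of_ne h (mul_ne_zero hv h1)
    have : v 0 / v 1 - w 0 / w 1 = (v 0 * w 1 - w 0 * v 1) / (v 1 * w 1) := by field_simp
    have := this ▸ div_neg_of_pos_of_neg hd hp
    linarith

/-- The relation `pl` makes `v 1` a positive combination of `u 1` and `w 1`, so the second
coordinates change sign at most once along `u, v, w`. Without a change the cut points decrease; a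
change rotates the order cyclically. -/
theorem cut_ratio_cyclic {u v w : Fin 2 → ℝ} (h₁ : 0 < u 0 * v 1 - v 0 * u 1)
    (h₂ : 0 < v 0 * w 1 - w 0 * v 1) (h₃ : 0 < u 0 * w 1 - w 0 * u 1) :
    (cut (ratio u) > cut (ratio v) ∧ cut (ratio v) > cut (ratio w)) ∨
    (cut (ratio v) > cut (ratio w) ∧ cut (ratio w) > cut (ratio u)) ∨
    (cut (ratio w) > cut (ratio u) ∧ cut (ratio u) > cut (ratio v)) := by
  have uv := cut_ratio_lt_of_nonneg h₁
  have vw := cut_ratio_lt_of_nonneg h₂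
  have wu := cut_ratio_lt_of_nonpos h₃
  have pl : (u 0 * v 1 - v 0 * u 1) * w 1 - (u 0 * w 1 - w 0 * u 1) * v 1 +
      (v 0 * w 1 - w 0 * v 1) * u 1 = 0 := by ring
  have hw0 : v 1 = 0 → w 1 ≠ 0 := fun h h' => by rw [h, h'] at h₂; simp at h₂
  have hu0 : v 1 = 0 → u 1 ≠ 0 := fun h h' => by rw [h, h'] at h₁; simp at h₁
  generalize u 0 * v 1 - v 0 * u 1 = D₁ at *
  generalize v 0 * w 1 - w 0 * v 1 = D₂ at *
  generalize u 0 * w 1 - w 0 * u 1 = D₃ at *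
  generalize u 1 = a at *
  generalize v 1 = b at *
  generalize w 1 = c at *
  by_cases hb : b = 0
  · subst hb
    -- Here `v` represents `∞`, and `pl` gives `a` and `c` opposite signs.
    refine Or.inr (Or.inl ⟨vw (hw0 rfl) (by simp), wu (hu0 rfl) ?_⟩)
    have : D₁ * (a * c) = -(D₂ * a ^ 2) := by linear_combination a * pl
    nlinarith [sq_nonneg a]
  have hb2 : 0 < b ^ 2 := by positivity
  rcases lt_or_ge (a * b) 0 with hab | hab
  · have hbc : 0 < b * c := by
      have : D₁ * (b * c) = D₃ * b ^ 2 - D₂ * (a * b) := by linear_combination b * pl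
      by_contra hn
      nlinarith [mul_pos h₃ hb2]
    have hac : a * c < 0 := by
      have : (a * b) * (b * c) = (a * c) * b ^ 2 := by ring
      by_contra hn
      nlinarith
    refine Or.inr (Or.inl ⟨vw (right_ne_zero_of_mul hbc.ne') hbc.le, wu
      (left_ne_zero_of_mul hac.ne) hac.le⟩)
  · rcases le_or_gt (b * c) 0 with hbc | hbc
    · have hab' : 0 < a * b := by
        have : D₂ * (a * b) = D₃ * b ^ 2 - D₁ * (b * c) := by linear_combination b * pl
        by_contra hn
        nlinarith [mul_pos h₃ hb2]
      have hac : a * c ≤ 0 := by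
        have : (a * b) * (b * c) = (a * c) * b ^ 2 := by ring
        by_contra hn
        nlinarith
      exact Or.inr (Or.inr ⟨wu (left_ne_zero_of_mul hab'.ne') hac, uv hb hab⟩)
    · exact Or.inl ⟨uv hb hab, vw (right_ne_zero_of_mul hbc.ne') hbc.le⟩

/-! ### Minors -/

theorem det_submatrix_pair {d : ℕ} (M : Matrix (Fin 2) (Fin d) ℝ) (i j : Fin d) :
    (M.submatrix id ![i, j]).det = M 0 i * M 1 j - M 0 j * M 1 i := by
  simp [det_fin_two]

/-- If all minors vanish, every column is a multiple of any fixed nonzero column, so the matrix is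
an outer product. Conversely a nonzero minor is an invertible submatrix. -/
theorem rank_eq_two_iff {d : ℕ} {M : Matrix (Fin 2) (Fin d) ℝ}
    (hM : ∀ j, (fun r => M r j) ≠ 0) :
    M.rank = 2 ↔ ∃ i j, M 0 i * M 1 j - M 0 j * M 1 i ≠ 0 := by
  constructor
  · intro h
    by_contra! hn
    have hle : M.rank ≤ 1 := by
      rcases isEmpty_or_nonempty (Fin d) with he | ⟨⟨j⟩⟩
      · have := M.rank_le_card_width
        simp [Fintype.card_eq_zero] at this
        omega
      obtain ⟨r, hr⟩ := Function.ne_iff.mp (hM j)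
      have hr : M r j ≠ 0 := hr
      have : M = vecMulVec (fun s => M s j) (fun i => M r i / M r j) := by
        ext s i
        rw [vecMulVec_apply]
        have := hn i j
        field_simp
        fin_cases r <;> fin_cases s <;> simp at * <;> linarith
      rw [this]
      exact rank_vecMulVec_le _ _
    omega
  · rintro ⟨i, j, h⟩
    rw [← det_submatrix_pair] at h
    have h2 := rank_of_isUnit (M.submatrix id ![i, j])
      ((Matrix.isUnit_iff_isUnit_det _).mpr h.isUnit)
    have h3 := rank_submatrix_le M id ![i, j]
    have h4 := M.rank_le_card_height
    simp at h2 h4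
    omega

/-! ### The matrix of a polygon -/

theorem map_ofReal_injective :
    Function.Injective (OnePoint.map ((↑) : ℝ → ℂ)) :=
  Option.map_injective Complex.ofReal_injective

namespace DecoratedPolygon

variable {d : ℕ}

theorem exists_spinVector (P : DecoratedPolygon d) (i : Fin d) : ∃ v : Fin 2 → ℝ, ∃ hv : v ≠ 0,
    spinLift ⟨realSpinor v, realSpinor_ne_zero hv⟩ = P.dec i :=
  exists_realSpinor_of_isPlanarAt (P.planar i)

/-- The real spin vector of a vertex. -/
noncomputable def spinVector (P : DecoratedPolygon d) (i : Fin d) : Fin 2 → ℝ :=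
  (P.exists_spinVector i).choose

theorem spinVector_ne_zero (P : DecoratedPolygon d) (i : Fin d) : P.spinVector i ≠ 0 :=
  (P.exists_spinVector i).choose_spec.choose

/-- The spin vector of a vertex, as a nonzero spinor. -/
noncomputable def spinor (P : DecoratedPolygon d) (i : Fin d) : {κ : Fin 2 → ℂ // κ ≠ 0} :=
  ⟨realSpinor (P.spinVector i), realSpinor_ne_zero (P.spinVector_ne_zero i)⟩

theorem spinLift_spinor (P : DecoratedPolygon d) (i : Fin d) :
    spinLift (P.spinor i) = P.dec i :=
  (P.exists_spinVector i).choose_spec.choose_spec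

theorem isSpinVectorOf_iff (P : DecoratedPolygon d) (i : Fin d) (κ : Fin 2 → ℂ) :
    IsSpinVectorOf κ (P.dec i) ↔ κ = realSpinor (P.spinVector i) := by
  constructor
  · rintro ⟨h, hκ⟩
    rw [← P.spinLift_spinor i] at hκ
    exact congrArg Subtype.val (spinLift_injective hκ)
  · rintro rfl
    exact ⟨_, P.spinLift_spinor i⟩

/-- The vertex is redundant data: planarity makes it the centre of the horosphere, and `ℝ ∪ {∞}`
embeds in `ℂ ∪ {∞}`. -/
theorem vertex_eq_ratio (P : DecoratedPolygon d) (i : Fin d) :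
    P.vertex i = ratio (P.spinVector i) := by
  apply map_ofReal_injective
  rw [← (P.planar i).1, ← P.spinLift_spinor i]
  exact spinLift_realSpinor_centre (P.spinVector_ne_zero i)

theorem eq_of_spinVector_eq {P Q : DecoratedPolygon d}
    (h : ∀ i, P.spinVector i = Q.spinVector i) : P = Q := by
  have hv : P.vertex = Q.vertex := funext fun i => by
    rw [vertex_eq_ratio, vertex_eq_ratio, h]
  have hd : P.dec = Q.dec := funext fun i => by
    rw [← P.spinLift_spinor i, ← Q.spinLift_spinor i]
    exact congrArg spinLift (Subtype.ext (congrArg realSpinor (h i)))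
  cases P
  cases Q
  cases hv
  cases hd
  rfl

theorem exists_of_spinVector (v : Fin d → Fin 2 → ℝ) (hv : ∀ i, v i ≠ 0) :
    ∃ P : DecoratedPolygon d, ∀ i, P.spinVector i = v i := by
  let P : DecoratedPolygon d :=
    { vertex := fun i => ratio (v i)
      dec := fun i => spinLift ⟨realSpinor (v i), realSpinor_ne_zero (hv i)⟩
      planar := fun i => spinLift_realSpinor_isPlanarAt (hv i) }
  exact ⟨P, fun i => realSpinor_injective
    ((P.isSpinVectorOf_iff i (realSpinor (v i))).mp ⟨_, rfl⟩).symm⟩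

/-- The minor of the spin vectors of two vertices. -/
noncomputable def minor (P : DecoratedPolygon d) (i j : Fin d) : ℝ :=
  P.spinVector i 0 * P.spinVector j 1 - P.spinVector j 0 * P.spinVector i 1

theorem minor_swap (P : DecoratedPolygon d) (i j : Fin d) : P.minor j i = -P.minor i j := by
  rw [minor, minor]; ring

theorem vertex_eq_iff (P : DecoratedPolygon d) (i j : Fin d) :
    P.vertex i = P.vertex j ↔ P.minor i j = 0 := by
  rw [vertex_eq_ratio, vertex_eq_ratio, minor,
    ratio_eq_iff (P.spinVector_ne_zero i) (P.spinVector_ne_zero j)]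

theorem isLambdaLength_iff (P : DecoratedPolygon d) {i j : Fin d}
    (h : P.vertex i ≠ P.vertex j) (l : ℝ) :
    IsLambdaLength (P.dec i) (P.dec j) l ↔ l = P.minor i j := by
  have hc : (spinLift (P.spinor i)).centre ≠ (spinLift (P.spinor j)).centre := by
    rw [P.spinLift_spinor, P.spinLift_spinor, (P.planar i).1, (P.planar j).1]
    exact fun he => h (map_ofReal_injective he)
  have hm : (P.spinor i).1 0 * (P.spinor j).1 1 - (P.spinor j).1 0 * (P.spinor i).1 1 =
      (P.minor i j : ℂ) := by
    simp [spinor, realSpinor, minor]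
  rw [← P.spinLift_spinor i, ← P.spinLift_spinor j]
  constructor
  · intro hl
    have := hl.eq_det hc
    rw [hm] at this
    exact_mod_cast this
  · rintro rfl
    have := isLambdaLength_det hc (by
      rw [hm]; exact_mod_cast fun h0 => h ((P.vertex_eq_iff i j).mpr h0))
    rwa [hm] at this

/-- Lambda lengths are minors, so antisymmetry gives the signs for `i > j`. Injectivity and cyclic
order both follow from the positive minors. -/
theorem ideal_and_spinCoherent_iff (P : DecoratedPolygon d) :
    P.IsIdealPolygon ∧ P.IsSpinCoherent ↔ ∀ i j, i < j → 0 < P.minor i j := by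
  constructor
  · rintro ⟨-, hinj, h⟩ i j hij
    obtain ⟨l, hl, hl'⟩ := (h i j).1 hij
    rwa [← (P.isLambdaLength_iff (hinj.ne hij.ne) l).mp hl']
  · intro h
    have hinj : Function.Injective P.vertex := by
      intro i j hij
      rw [vertex_eq_iff] at hij
      rcases lt_trichotomy i j with hl | he | hl
      · exact absurd hij (h i j hl).ne'
      · exact he
      · have := h j i hl
        rw [minor_swap, hij] at this
        simp at this
    refine ⟨⟨hinj, fun i j k hij hjk => ?_⟩, hinj, fun i j => ⟨fun hij => ?_, fun hij => ?_⟩⟩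
    · simp only [vertex_eq_ratio]
      exact cut_ratio_cyclic (h i j hij) (h j k hjk) (h i k (hij.trans hjk))
    · exact ⟨_, h i j hij, (P.isLambdaLength_iff (hinj.ne hij.ne) _).mpr rfl⟩
    · refine ⟨P.minor i j, ?_, (P.isLambdaLength_iff (hinj.ne hij.ne') _).mpr rfl⟩
      rw [minor_swap]
      exact neg_neg_of_pos (h j i hij)

end DecoratedPolygon

theorem bijOn_of_mem_iff {α β : Type*} {f : α → β} {T T' : Set β} {S : Set α}
    (hf : Set.BijOn f Set.univ T) (hT : T' ⊆ T) (h : ∀ x, x ∈ S ↔ f x ∈ T') :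
    Set.BijOn f S T' := by
  refine ⟨fun x hx => (h x).mp hx, hf.injOn.mono (Set.subset_univ S), fun y hy => ?_⟩
  obtain ⟨x, -, rfl⟩ := hf.surjOn (hT hy)
  exact ⟨x, (h x).mpr hy, rfl⟩

end SpinHyp

/-- The correspondence `Φ` takes the columns of the matrix to be the spinors corresponding to the
planar spin decorations, which are real. It restricts to bijections from all generalised ideal
`d`-gons with planar spin decorations onto the `2 × d` real matrices without zero columns, from the
nondegenerate ones onto those of rank 2, and from the spin-coherent ideal `d`-gons onto the matrices
all of whose `2 × 2` minors are positive. -/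
theorem mainTheorem12 (d : ℕ) :
    ∃ Φ : SpinHyp.DecoratedPolygon d → Matrix (Fin 2) (Fin d) ℝ,
      (∀ (P : SpinHyp.DecoratedPolygon d) (i : Fin d) (κ : Fin 2 → ℂ),
        SpinHyp.IsSpinVectorOf κ (P.dec i) ↔ κ = fun r => ((Φ P r i : ℝ) : ℂ)) ∧
      Set.BijOn Φ Set.univ {M | ∀ j, (fun r => M r j) ≠ 0} ∧
      Set.BijOn Φ {P | ¬ P.IsDegenerate} {M | (∀ j, (fun r => M r j) ≠ 0) ∧ M.rank = 2} ∧
      (2 ≤ d → Set.BijOn Φ {P | P.IsIdealPolygon ∧ P.IsSpinCoherent}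
        {M | ∀ i j, i < j → 0 < (M.submatrix id ![i, j]).det}) := by
  refine ⟨fun P => Matrix.of fun r i => P.spinVector i r,
    fun P i κ => P.isSpinVectorOf_iff i κ, ?_⟩
  have hbij : Set.BijOn (fun P : SpinHyp.DecoratedPolygon d =>
      (Matrix.of fun r i => P.spinVector i r : Matrix (Fin 2) (Fin d) ℝ)) Set.univ
      {M | ∀ j, (fun r => M r j) ≠ 0} := by
    refine ⟨fun P _ j => P.spinVector_ne_zero j, fun P _ Q _ h => ?_, fun M hM => ?_⟩
    · exact SpinHyp.DecoratedPolygon.eq_of_spinVector_eq fun i =>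
        funext fun r => congrFun (congrFun h r) i
    · obtain ⟨P, hP⟩ := SpinHyp.DecoratedPolygon.exists_of_spinVector (fun i r => M r i) hM
      exact ⟨P, Set.mem_univ P, Matrix.ext fun r i => congrFun (hP i) r⟩
  refine ⟨hbij, SpinHyp.bijOn_of_mem_iff hbij (fun M hM => hM.1) fun P => ?_,
    fun hd => SpinHyp.bijOn_of_mem_iff hbij (fun M hM j => ?_) fun P => ?_⟩
  -- Vertices coincide when their minor is zero, so nondegeneracy says that some minor is nonzero.
  · have hne : ∀ j, (fun r => (Matrix.of fun r i => P.spinVector i r :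
        Matrix (Fin 2) (Fin d) ℝ) r j) ≠ 0 := P.spinVector_ne_zero
    refine Iff.trans ?_ (and_iff_right hne).symm
    rw [SpinHyp.rank_eq_two_iff hne]
    change ¬ (∀ i j, P.vertex i = P.vertex j) ↔ ∃ i j, P.minor i j ≠ 0
    simp only [P.vertex_eq_iff, not_forall, ne_eq]
  -- For `d ≥ 2` each column occurs in some minor, which would vanish with the column; a single
  -- column has no minors to exclude zero.
  · intro h0
    have h0 (r) : M r j = 0 := congrFun h0 r
    have : Nontrivial (Fin d) := Fin.nontrivial_iff_two_le.mpr hd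
    obtain ⟨k, hk⟩ := exists_ne j
    rcases lt_or_gt_of_ne hk with hk | hk
    · have h := hM k j hk
      rw [SpinHyp.det_submatrix_pair, h0, h0] at h
      simp at h
    · have h := hM j k hk
      rw [SpinHyp.det_submatrix_pair, h0, h0] at h
      simp at h
  · refine P.ideal_and_spinCoherent_iff.trans ?_
    refine forall_congr' fun i => forall_congr' fun j => imp_congr_right fun _ => ?_
    rw [SpinHyp.det_submatrix_pair]
    rfl
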